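/- For an integer $m\ge 1$ let $\mathcal X_m\le U(2^m)$ be the complex Clifford group of genus $m$: with $(e_v)_{v\in\mathbb F_2^m}$ an orthonormal basis of $\mathbb C^{2^m}$, it is the group generated by - the diagonal maps $d_S(e_v)=i^{S[v]}e_v$, where $S$ is a symmetric integral $m\times m$ matrix and $S[v]=v^{T}Sv$ with the entries of $v$ regarded as the integers $0,1$; - the permutations $m_{g,v'}(e_v)=e_{gv+v'}$ for $g\in \mathrm{GL}(m,2)$ and $v'\in\mathbb F_2^m$; - $h\otimes I_2\otimes\cdots\otimes I_2$, where $h=\frac1{\sqrt2}\begin{pmatrix}1&1\\1&-1\end{pmatrix}$. A matrix $U\in\mathcal X_m$ acts on the ring $\mathbb C[x_v,\overline{x_v}:v\in\mathbb F_2^m]$ of conjugate polynomials by the algebra automorphism $x_v\mapsto\sum_w U_{wv}x_w$, $\overline{x_v}\mapsto\sum_w\overline{U_{wv}}\,\overline{x_w}$. Let $\alpha_m(N_1,N_2)$ be the dimension of the space of $\mathcal X_m$-invariant conjugate polynomials that are homogeneous of degree $N_1$ in the $x_v$ and of degree $N_2$ in the $\overline{x_v}$. The Forger (bivariate Molien)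 series of $\mathcal X_m$ is the formal power series $$\mathrm{FS}_m(t,\bar t)=\sum_{N_1,N_2\ge0}\alpha_m(N_1,N_2)\,t^{N_1}\bar t^{N_2}.$$ A binary code of length $(N_1,N_2)$ is a subspace $C$ of $\mathbb F_2^{N_1+N_2}$. It is self-dual if $C=C^\perp$ with respect to $\beta(x,y)=\sum_{i\le N_1}x_iy_i-\sum_{i>N_1}x_iy_i$, and doubly-even if for every $c\in C$ the integer $\mathrm{wt}(c)=\sum_{i\le N_1}c_i-\sum_{i>N_1}c_i$ (entries regarded as the integers $0,1$) is divisible by $4$. Two codes of length $(N_1,N_2)$ are permutation-equivalent if one is obtained from the other by permuting the first $N_1$ coordinates among themselves and the last $N_2$ coordinates among themselves. Let $a_{N_1,N_2}$ be the number of permutation-equivalence classes of binary doubly-even self-dual codes of length $(N_1,N_2)$. **Corollary.** As $m$ tends to infinity, $\mathrm{FS}_m$ converges monotonically: for $1\le m\le m'$ every coefficient of $\mathrm{FS}_m$ is at most the corresponding coefficient of $\mathrm{FS}_{m'}$, and, coefficientwise as formal power series, $$\lim_{m\to\infty}\mathrm{FS}_m(t,\bar t)=\sum_{N_1=0}^\infty\sum_{N_2=0}^\infty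 a_{N_1,N_2}\,t^{N_1}\bar t^{N_2}.$$ -/

import Mathlib

open scoped MvPowerSeries.WithPiTopology

namespace CliffordInv

noncomputable section

/-! ### The complex Clifford group of genus `m`

The orthonormal basis `e_v` of `ℂ^(2^m)` is indexed by `v : Fin m → ZMod 2`; a linear map is given
by its matrix `U`, so that `U e_v = ∑ w, U w v • e_w`. -/

/-- The index set `𝔽₂^m`. -/
abbrev Vec (m : ℕ) : Type := Fin m → ZMod 2

/-- The entries of `v ∈ 𝔽₂^m` regarded as integers `0`, `1`. -/
def intLift {m : ℕ} (v : Vec m) : Fin m → ℤ := fun i => ((v i).val : ℤ)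

/-- `S[v] = vᵀ S v`, with the entries of `v` regarded as integers. -/
def quadVal {m : ℕ} (S : Matrix (Fin m) (Fin m) ℤ) (v : Vec m) : ℤ :=
  intLift v ⬝ᵥ S.mulVec (intLift v)

/-- The matrix of `d_S : e_v ↦ i^{S[v]} e_v`. -/
def diagMatrix {m : ℕ} (S : Matrix (Fin m) (Fin m) ℤ) : Matrix (Vec m) (Vec m) ℂ :=
  Matrix.diagonal fun v => Complex.I ^ quadVal S v

theorem diagMatrix_mem {m : ℕ} (S : Matrix (Fin m) (Fin m) ℤ) :
    diagMatrix S ∈ Matrix.unitaryGroup (Vec m) ℂ := by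
  rw [Matrix.mem_unitaryGroup_iff, diagMatrix, Matrix.star_eq_conjTranspose,
    Matrix.diagonal_conjTranspose, Matrix.diagonal_mul_diagonal, ← Matrix.diagonal_one]
  congr 1
  funext v
  simp [← mul_zpow]

/-- The matrix of `m_{g,v'} : e_v ↦ e_{g v + v'}`. -/
def permMatrix {m : ℕ} (g : Matrix.GeneralLinearGroup (Fin m) (ZMod 2)) (v' : Vec m) :
    Matrix (Vec m) (Vec m) ℂ :=
  Matrix.of fun w v => if w = (g : Matrix (Fin m) (Fin m) (ZMod 2)).mulVec v + v' then 1 else 0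

theorem permMatrix_mem {m : ℕ} (g : Matrix.GeneralLinearGroup (Fin m) (ZMod 2)) (v' : Vec m) :
    permMatrix g v' ∈ Matrix.unitaryGroup (Vec m) ℂ := by
  have hinj : Function.Injective
      fun v : Vec m => (g : Matrix (Fin m) (Fin m) (ZMod 2)).mulVec v + v' := by
    intro v w h
    exact Matrix.mulVec_injective_of_isUnit g.isUnit (add_right_cancel h)
  rw [Matrix.mem_unitaryGroup_iff']
  ext v w
  simp only [Matrix.mul_apply, Matrix.star_apply, permMatrix, Matrix.of_apply, Matrix.one_apply]
  rw [Finset.sum_eq_single ((g : Matrix (Fin m) (Fin m) (ZMod 2)).mulVec w + v')]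
  · by_cases h : v = w
    · simp [h]
    · have : ¬ ((g : Matrix (Fin m) (Fin m) (ZMod 2)).mulVec w + v' =
          (g : Matrix (Fin m) (Fin m) (ZMod 2)).mulVec v + v') := fun e => h (hinj e.symm)
      simp only [if_neg this, if_neg h]
      simp
  · intro b _ hb
    simp [hb]
  · simp

/-- The Hadamard matrix `h = (1/√2) [[1, 1], [1, -1]]`, with rows and columns indexed by `𝔽₂`. -/
def hadamard : Matrix (ZMod 2) (ZMod 2) ℂ :=
  Matrix.of fun a b => (1 / (Real.sqrt 2 : ℂ)) * (if a = 1 ∧ b = 1 then -1 else 1)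

/-- The tensor product `A₀ ⊗ ⋯ ⊗ A_{m-1}` of `2 × 2` matrices. -/
def tensorMatrix {m : ℕ} (A : Fin m → Matrix (ZMod 2) (ZMod 2) ℂ) : Matrix (Vec m) (Vec m) ℂ :=
  Matrix.of fun w v => ∏ i, A i (w i) (v i)

/-- The matrix `I ⊗ ⋯ ⊗ h ⊗ ⋯ ⊗ I` with `h` in the tensor factor `j`. -/
def hadamardAt {m : ℕ} (j : Fin m) : Matrix (Vec m) (Vec m) ℂ :=
  tensorMatrix fun i => if i = j then hadamard else 1

theorem hadamard_mem : hadamard ∈ Matrix.unitaryGroup (ZMod 2) ℂ := by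
  have h2 : ((Real.sqrt 2 : ℝ) : ℂ) * ((Real.sqrt 2 : ℝ) : ℂ) = 2 := by
    rw [← Complex.ofReal_mul, Real.mul_self_sqrt (by norm_num)]; norm_num
  have h3 : ((Real.sqrt 2 : ℝ) : ℂ)⁻¹ * ((Real.sqrt 2 : ℝ) : ℂ)⁻¹ = 1 / 2 := by
    rw [← mul_inv, h2]; norm_num
  have hsum : ∀ f : ZMod 2 → ℂ, ∑ x, f x = f 0 + f 1 := fun f => Fin.sum_univ_two f
  rw [Matrix.mem_unitaryGroup_iff]
  ext a b
  have h01 : (0 : ZMod 2) ≠ 1 := by decide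
  have key : ∀ x : ZMod 2, x = 0 ∨ x = 1 := by decide
  rcases key a with rfl | rfl <;> rcases key b with rfl | rfl <;>
    simp [Matrix.mul_apply, hsum, hadamard, Matrix.star_apply, h3] <;> norm_num

theorem tensorMatrix_mem {m : ℕ} (A : Fin m → Matrix (ZMod 2) (ZMod 2) ℂ)
    (hA : ∀ i, A i ∈ Matrix.unitaryGroup (ZMod 2) ℂ) :
    tensorMatrix A ∈ Matrix.unitaryGroup (Vec m) ℂ := by
  rw [Matrix.mem_unitaryGroup_iff]
  ext w v
  have h1 : ∀ i, ∑ b, A i (w i) b * star (A i (v i) b) =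
      (1 : Matrix (ZMod 2) (ZMod 2) ℂ) (w i) (v i) := by
    intro i
    rw [← Matrix.mem_unitaryGroup_iff.1 (hA i), Matrix.mul_apply]
    rfl
  simp only [Matrix.mul_apply, Matrix.star_apply, tensorMatrix, Matrix.of_apply, star_prod,
    ← Finset.prod_mul_distrib]
  rw [← Fintype.prod_sum (fun i b => A i (w i) b * star (A i (v i) b))]
  simp only [h1, Matrix.one_apply]
  by_cases h : w = v
  · simp [h]
  · obtain ⟨i, hi⟩ := Function.ne_iff.1 h
    rw [if_neg h]
    exact Finset.prod_eq_zero (Finset.mem_univ i) (if_neg hi)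

theorem hadamardAt_mem {m : ℕ} (j : Fin m) :
    hadamardAt j ∈ Matrix.unitaryGroup (Vec m) ℂ := by
  refine tensorMatrix_mem _ fun i => ?_
  split_ifs
  · exact hadamard_mem
  · exact one_mem _

/-- The complex Clifford group `𝒳_m` of genus `m ≥ 1`: the subgroup of `U(2^m)` generated by
all `d_S` (`S` symmetric integral), all `m_{g,v'}`, and `h ⊗ I ⊗ ⋯ ⊗ I`. -/
def cliffordGroup (m : ℕ) : Subgroup (Matrix.unitaryGroup (Vec m) ℂ) :=
  Subgroup.closure
    ({U | ∃ S : Matrix (Fin m) (Fin m) ℤ, S.IsSymm ∧ U = ⟨diagMatrix S, diagMatrix_mem S⟩} ∪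
      {U | ∃ (g : Matrix.GeneralLinearGroup (Fin m) (ZMod 2)) (v' : Vec m),
        U = ⟨permMatrix g v', permMatrix_mem g v'⟩} ∪
      {U | ∃ j : Fin m, (j : ℕ) = 0 ∧ U = ⟨hadamardAt j, hadamardAt_mem j⟩})

/-! ### Conjugate polynomials, conjugate invariants and the Forger series -/

/-- The ring `ℂ[x_v, x̄_v : v ∈ n]` of conjugate polynomials; `Sum.inl v` indexes the variable
`x_v` and `Sum.inr v` the variable `x̄_v`. -/
abbrev ConjPoly (n : Type) : Type := MvPolynomial (n ⊕ n) ℂ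

/-- The action of `U` on conjugate polynomials: `x_v ↦ ∑ w, U w v x_w` and
`x̄_v ↦ ∑ w, conj (U w v) x̄_w`. -/
def conjAct {n : Type} [Fintype n] (U : Matrix n n ℂ) : ConjPoly n →ₐ[ℂ] ConjPoly n :=
  MvPolynomial.aeval (Sum.elim
    (fun v => ∑ w, MvPolynomial.C (U w v) * MvPolynomial.X (Sum.inl w))
    (fun v => ∑ w, MvPolynomial.C (star (U w v)) * MvPolynomial.X (Sum.inr w)))

/-- The bidegree of the variables: `(1, 0)` for `x_v` and `(0, 1)` for `x̄_v`. -/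
def bidegree (n : Type) : n ⊕ n → ℕ × ℕ := Sum.elim (fun _ => (1, 0)) (fun _ => (0, 1))

/-- The space of `G`-invariant conjugate polynomials, homogeneous of degree `N₁` in the `x_v`
and of degree `N₂` in the `x̄_v`. -/
def conjInvariants {n : Type} [Fintype n] [DecidableEq n]
    (G : Subgroup (Matrix.unitaryGroup n ℂ)) (N₁ N₂ : ℕ) : Submodule ℂ (ConjPoly n) where
  carrier := {p | p ∈ MvPolynomial.weightedHomogeneousSubmodule ℂ (bidegree n) (N₁, N₂) ∧
    ∀ U ∈ G, conjAct (U : Matrix n n ℂ) p = p}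
  zero_mem' := ⟨Submodule.zero_mem _, fun _ _ => map_zero _⟩
  add_mem' := fun ha hb => ⟨Submodule.add_mem _ ha.1 hb.1, fun U hU => by
    rw [map_add, ha.2 U hU, hb.2 U hU]⟩
  smul_mem' := fun c _ ha => ⟨Submodule.smul_mem _ c ha.1, fun U hU => by
    rw [map_smul, ha.2 U hU]⟩

/-- The Forger series `∑ α(N₁, N₂) t^{N₁} t̄^{N₂}` of `G`, a formal power series in two variables
(`0` is `t`, `1` is `t̄`), where `α(N₁, N₂)` is the dimension of the space of homogeneous
conjugate invariants of degree `(N₁, N₂)`. -/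
def forgerSeries {n : Type} [Fintype n] [DecidableEq n]
    (G : Subgroup (Matrix.unitaryGroup n ℂ)) : MvPowerSeries (Fin 2) ℕ :=
  fun d => Module.finrank ℂ (conjInvariants G (d 0) (d 1))

/-! ### Binary codes of length `(N₁, N₂)` -/

/-- Binary words of length `(N₁, N₂)`. -/
abbrev Word (N₁ N₂ : ℕ) : Type := Fin N₁ ⊕ Fin N₂ → ZMod 2

/-- Binary linear codes of length `(N₁, N₂)`. -/
abbrev Code (N₁ N₂ : ℕ) : Type := Submodule (ZMod 2) (Word N₁ N₂)

/-- `β(x, y) = x₁y₁ + ⋯ + x_{N₁}y_{N₁} - x_{N₁+1}y_{N₁+1} - ⋯ - x_{N₁+N₂}y_{N₁+N₂}`. -/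
def beta {N₁ N₂ : ℕ} (x y : Word N₁ N₂) : ZMod 2 :=
  ∑ i, x (Sum.inl i) * y (Sum.inl i) - ∑ j, x (Sum.inr j) * y (Sum.inr j)

/-- `C = C^⊥` with respect to `β`. -/
def IsSelfDual {N₁ N₂ : ℕ} (C : Code N₁ N₂) : Prop :=
  (C : Set (Word N₁ N₂)) = {c' | ∀ c ∈ C, beta c c' = 0}

/-- The signed weight `wt(c) = c₁ + ⋯ + c_{N₁} - c_{N₁+1} - ⋯ - c_{N₁+N₂} ∈ ℤ`. -/
def wt {N₁ N₂ : ℕ} (c : Word N₁ N₂) : ℤ :=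
  ∑ i, ((c (Sum.inl i)).val : ℤ) - ∑ j, ((c (Sum.inr j)).val : ℤ)

/-- The weight of each codeword is divisible by `4`. -/
def IsDoublyEven {N₁ N₂ : ℕ} (C : Code N₁ N₂) : Prop := ∀ c ∈ C, (4 : ℤ) ∣ wt c

/-- The binary doubly-even self-dual codes of length `(N₁, N₂)`. -/
abbrev DESDCode (N₁ N₂ : ℕ) : Type := {C : Code N₁ N₂ // IsDoublyEven C ∧ IsSelfDual C}

/-- Permutation equivalence: one code is carried to the other by a permutation of the first `N₁`
coordinates together with a permutation of the last `N₂` coordinates. -/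
def PermEquiv {N₁ N₂ : ℕ} (C D : Code N₁ N₂) : Prop :=
  ∃ (σ : Equiv.Perm (Fin N₁)) (τ : Equiv.Perm (Fin N₂)),
    ∀ c : Word N₁ N₂, c ∈ C ↔ c ∘ Sum.map σ τ ∈ D

/-- Permutation equivalence as an equivalence relation on doubly-even self-dual codes. -/
def permSetoid (N₁ N₂ : ℕ) : Setoid (DESDCode N₁ N₂) where
  r C D := PermEquiv C.1 D.1
  iseqv :=
    { refl := fun C => ⟨1, 1, fun c => by
        have : c ∘ Sum.map (1 : Equiv.Perm (Fin N₁)) (1 : Equiv.Perm (Fin N₂)) = c := by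
          funext x; cases x <;> rfl
        rw [this]⟩
      symm := by
        rintro C D ⟨σ, τ, h⟩
        refine ⟨σ⁻¹, τ⁻¹, fun c => ?_⟩
        rw [h]
        have : (c ∘ Sum.map (σ⁻¹ : Equiv.Perm (Fin N₁)) (τ⁻¹ : Equiv.Perm (Fin N₂))) ∘
            Sum.map σ τ = c := by
          funext x; cases x <;> simp
        rw [this]
      trans := by
        rintro C D E ⟨σ, τ, h⟩ ⟨σ', τ', h'⟩
        refine ⟨σ * σ', τ * τ', fun c => ?_⟩
        rw [h, h']
        have : (c ∘ Sum.map σ τ) ∘ Sum.map σ' τ' =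
            c ∘ Sum.map (σ * σ' : Equiv.Perm (Fin N₁)) (τ * τ' : Equiv.Perm (Fin N₂)) := by
          funext x; cases x <;> rfl
        rw [this] }

/-- `a_{N₁,N₂}`: the number of permutation-equivalence classes of binary doubly-even self-dual
codes of length `(N₁, N₂)`. -/
def numClasses (N₁ N₂ : ℕ) : ℕ := Nat.card (Quotient (permSetoid N₁ N₂))

/-- The formal power series `∑ a_{N₁,N₂} t^{N₁} t̄^{N₂}`. -/
def codeSeries : MvPowerSeries (Fin 2) ℕ := fun d => numClasses (d 0) (d 1)

end

end CliffordInv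

namespace CliffordInv

noncomputable section

set_option linter.unusedSectionVars false

open Finset

/-! ### Tensors and conjugate polynomials -/

/-! A bihomogeneous invariant polarizes to a symmetric tensor in V^{⊗N₁} ⊗ V̄^{⊗N₂} fixed by the
group (`exists_tensor_lift`). A basis tensor is an m × (N₁+N₂) binary matrix M, and each generator
acts through the rows of M. The map d_S multiplies M by a power of i governed by the signed products
of rows, so a fixed tensor is supported on matrices with doubly-even row span. The maps m_{g,0} are
row operations, so its coefficients depend on the row span only. By Möbius inversion over inclusion
of codes, it is a combination of the tensors `codeTensor m C` with C doubly-even.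

The Hadamard generator is a Fourier transform in one row. Averaged over row operations and cut off
to doubly-even row spans, it becomes an operator that fixes the invariant tensors and sends the
tensor of C to a combination of those of C and of the doubly-even codes covering C
(`parabolicFourier_codeTensor`). If C is self-dual its tensor is fixed; otherwise the diagonal entry
is at most |C| / √2^(N₁+N₂) < 1. By triangularity a fixed vector involves self-dual codes only.
Since weight enumerators of doubly-even self-dual codes are invariant, they span exactly the
invariants (`conjInvariants_eq_span`).

Setting variables to zero maps the enumerator of C in genus m' to the one in genus m, which gives
monotonicity. Once m ≥ N₁+N₂, every code is a row span, and suitable coefficients separate the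
enumerators of inequivalent codes (`finrank_conjInvariants_eq`). -/

/-- The coordinate positions of a word of length `(N₁, N₂)`. -/
abbrev Pos (N₁ N₂ : ℕ) : Type := Fin N₁ ⊕ Fin N₂

/-- The identity at the first `N₁` positions, complex conjugation at the last `N₂` positions. -/
def twist {N₁ N₂ : ℕ} (p : Pos N₁ N₂) (z : ℂ) : ℂ := Sum.elim (fun _ => z) (fun _ => star z) p

/-- The index of the variable that `v` contributes at the position `p`. -/
def tag {n : Type} {N₁ N₂ : ℕ} (p : Pos N₁ N₂) (v : n) : n ⊕ n :=
  Sum.elim (fun _ => Sum.inl v) (fun _ => Sum.inr v) p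

section Tensor

variable {n : Type} [Fintype n] [DecidableEq n] {N₁ N₂ : ℕ}

/-- The action of a matrix on `V^{⊗N₁} ⊗ V̄^{⊗N₂}`, tensors being given by their coordinates. -/
def tensAct (U : Matrix n n ℂ) : ((Pos N₁ N₂ → n) → ℂ) →ₗ[ℂ] ((Pos N₁ N₂ → n) → ℂ) where
  toFun f M' := ∑ M, (∏ p, twist p (U (M' p) (M p))) * f M
  map_add' f g := by funext M'; simp [mul_add, sum_add_distrib]
  map_smul' c f := by
    funext M'; simp only [Pi.smul_apply, smul_eq_mul, mul_sum, RingHom.id_apply]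
    exact sum_congr rfl fun M _ => by ring

theorem tensAct_apply (U : Matrix n n ℂ) (f : (Pos N₁ N₂ → n) → ℂ) (M' : Pos N₁ N₂ → n) :
    tensAct U f M' = ∑ M, (∏ p, twist p (U (M' p) (M p))) * f M := rfl

/-- The exponent of the monomial attached to a basis tensor. -/
def expo (M : Pos N₁ N₂ → n) : n ⊕ n →₀ ℕ := ∑ p, Finsupp.single (tag p (M p)) 1

/-- The conjugate polynomial attached to a tensor. -/
def toPoly : ((Pos N₁ N₂ → n) → ℂ) →ₗ[ℂ] ConjPoly n where
  toFun f := ∑ M, MvPolynomial.C (f M) * ∏ p, MvPolynomial.X (tag p (M p))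
  map_add' f g := by simp [add_mul, sum_add_distrib]
  map_smul' c f := by simp [MvPolynomial.smul_eq_C_mul, mul_sum, mul_assoc]

theorem toPoly_apply (f : (Pos N₁ N₂ → n) → ℂ) :
    toPoly f = ∑ M, MvPolynomial.C (f M) * ∏ p, MvPolynomial.X (tag p (M p)) := rfl

theorem toPoly_eq_sum_monomial (f : (Pos N₁ N₂ → n) → ℂ) :
    toPoly f = ∑ M, MvPolynomial.monomial (expo M) (f M) := by
  rw [toPoly_apply]
  refine sum_congr rfl fun M _ => ?_
  rw [expo, ← mul_one (f M), ← MvPolynomial.C_mul_monomial, MvPolynomial.monomial_sum_one, mul_one]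
  rfl

theorem coeff_toPoly (f : (Pos N₁ N₂ → n) → ℂ) (d : n ⊕ n →₀ ℕ) :
    MvPolynomial.coeff d (toPoly f) = ∑ M with expo M = d, f M := by
  rw [toPoly_eq_sum_monomial, MvPolynomial.coeff_sum, sum_filter]
  exact sum_congr rfl fun M _ => MvPolynomial.coeff_monomial _ _ _

theorem conjAct_X_tag (U : Matrix n n ℂ) (p : Pos N₁ N₂) (v : n) :
    conjAct U (MvPolynomial.X (tag p v)) =
      ∑ w, MvPolynomial.C (twist p (U w v)) * MvPolynomial.X (tag p w) := by
  cases p <;> simp [conjAct, tag, twist]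

theorem conjAct_toPoly (U : Matrix n n ℂ) (f : (Pos N₁ N₂ → n) → ℂ) :
    conjAct U (toPoly f) = toPoly (tensAct U f) := by
  have hC : ∀ z : ℂ, conjAct U (MvPolynomial.C z) = MvPolynomial.C z := fun z =>
    (conjAct U).commutes z
  simp only [toPoly_apply, map_sum, map_mul, map_prod, hC, conjAct_X_tag, tensAct_apply]
  simp only [Fintype.prod_sum, sum_mul, mul_sum, prod_mul_distrib]
  rw [sum_comm]
  exact sum_congr rfl fun M' _ => sum_congr rfl fun M _ => by ring

theorem expo_inl (M : Pos N₁ N₂ → n) (v : n) :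
    expo M (Sum.inl v) = #{i : Fin N₁ | M (Sum.inl i) = v} := by
  simp [expo, tag, Finsupp.single_apply]

theorem expo_inr (M : Pos N₁ N₂ → n) (v : n) :
    expo M (Sum.inr v) = #{j : Fin N₂ | M (Sum.inr j) = v} := by
  simp [expo, tag, Finsupp.single_apply]

theorem exists_perm_of_card_fiber_eq {k : ℕ} (f g : Fin k → n)
    (h : ∀ v, #{i | f i = v} = #{i | g i = v}) : ∃ σ : Equiv.Perm (Fin k), f = g ∘ σ := by
  have e : ∀ v, {i // f i = v} ≃ {i // g i = v} := fun v =>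
    Fintype.equivOfCardEq (by rw [Fintype.card_subtype, Fintype.card_subtype, h v])
  exact ⟨Equiv.ofFiberEquiv e, funext fun i => (Equiv.ofFiberEquiv_map e i).symm⟩

/-- A monomial records only how often each column occurs among the first N₁ and among the last N₂
positions, and equal multiplicities are matched fibre by fibre. -/
theorem expo_eq_iff (M M' : Pos N₁ N₂ → n) : expo M = expo M' ↔
    ∃ (σ : Equiv.Perm (Fin N₁)) (τ : Equiv.Perm (Fin N₂)), M = M' ∘ Sum.map σ τ := by
  constructor
  · intro h
    obtain ⟨σ, hσ⟩ := exists_perm_of_card_fiber_eq (M ∘ Sum.inl) (M' ∘ Sum.inl)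
      (fun v => by
        have := DFunLike.congr_fun h (Sum.inl v)
        rwa [expo_inl, expo_inl] at this)
    obtain ⟨τ, hτ⟩ := exists_perm_of_card_fiber_eq (M ∘ Sum.inr) (M' ∘ Sum.inr)
      (fun v => by
        have := DFunLike.congr_fun h (Sum.inr v)
        rwa [expo_inr, expo_inr] at this)
    exact ⟨σ, τ, funext fun p => by
      cases p with
      | inl i => exact congrFun hσ i
      | inr j => exact congrFun hτ j⟩
  · rintro ⟨σ, τ, rfl⟩
    rw [expo, expo, ← Equiv.sum_comp (Equiv.sumCongr σ τ)
      (fun p => Finsupp.single (tag p (M' p)) 1)]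
    refine sum_congr rfl fun p _ => ?_
    cases p <;> rfl

theorem exists_card_fiber_eq {k : ℕ} (c : n → ℕ) (h : ∑ v, c v = k) :
    ∃ g : Fin k → n, ∀ v, #{i | g i = v} = c v := by
  have e : Fin k ≃ Σ v, Fin (c v) := Fintype.equivOfCardEq (by simp [h])
  refine ⟨fun i => (e i).1, fun v => ?_⟩
  rw [← Fintype.card_subtype, Fintype.card_congr (e.subtypeEquiv (q := fun x => x.1 = v)
    fun _ => Iff.rfl), Fintype.card_congr (Equiv.sigmaSubtype v), Fintype.card_fin]

theorem weight_bidegree (d : n ⊕ n →₀ ℕ) : Finsupp.weight (bidegree n) d =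
    (∑ v, d (Sum.inl v), ∑ v, d (Sum.inr v)) := by
  rw [Finsupp.weight_apply, Finsupp.sum_fintype _ _ (fun v => zero_smul ℕ (bidegree n v)),
    Fintype.sum_sum_type]
  simp [bidegree, Prod.ext_iff, Prod.fst_sum, Prod.snd_sum]

theorem exists_expo_eq_iff (d : n ⊕ n →₀ ℕ) :
    (∃ M : Pos N₁ N₂ → n, expo M = d) ↔ Finsupp.weight (bidegree n) d = (N₁, N₂) := by
  rw [weight_bidegree, Prod.mk.injEq]
  constructor
  · rintro ⟨M, rfl⟩
    simp only [expo_inl, expo_inr]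
    rw [← card_eq_sum_card_fiberwise (fun _ _ => mem_univ _),
      ← card_eq_sum_card_fiberwise (fun _ _ => mem_univ _)]
    simp
  · rintro ⟨h₁, h₂⟩
    obtain ⟨f, hf⟩ := exists_card_fiber_eq _ h₁
    obtain ⟨g, hg⟩ := exists_card_fiber_eq _ h₂
    refine ⟨Sum.elim f g, Finsupp.ext fun v => ?_⟩
    cases v with
    | inl v => rw [expo_inl]; exact hf v
    | inr v => rw [expo_inr]; exact hg v

theorem toPoly_mem (f : (Pos N₁ N₂ → n) → ℂ) :
    toPoly f ∈ MvPolynomial.weightedHomogeneousSubmodule ℂ (bidegree n) (N₁, N₂) := by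
  intro d hd
  rw [← exists_expo_eq_iff]
  by_contra! h
  exact hd (by rw [coeff_toPoly, filter_false_of_mem fun M _ => h M, sum_empty])

/-- Invariance of a tensor under the permutations of the first `N₁` and of the last `N₂` factors. -/
def IsSymmTensor (f : (Pos N₁ N₂ → n) → ℂ) : Prop :=
  ∀ (σ : Equiv.Perm (Fin N₁)) (τ : Equiv.Perm (Fin N₂)) (M : Pos N₁ N₂ → n),
    f (M ∘ Sum.map σ τ) = f M

/-- Each coefficient is shared equally among the basis tensors with that exponent; this uses
characteristic zero. -/
theorem exists_symm_toPoly_eq {p : ConjPoly n}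
    (hp : p ∈ MvPolynomial.weightedHomogeneousSubmodule ℂ (bidegree n) (N₁, N₂)) :
    ∃ f : (Pos N₁ N₂ → n) → ℂ, IsSymmTensor f ∧ toPoly f = p := by
  refine ⟨fun M => MvPolynomial.coeff (expo M) p / #{M' : Pos N₁ N₂ → n | expo M' = expo M},
    fun σ τ M => ?_, ?_⟩
  · have : expo (M ∘ Sum.map σ τ) = expo M := (expo_eq_iff _ _).2 ⟨σ, τ, rfl⟩
    simp only [this]
  · ext d
    rw [coeff_toPoly]
    by_cases h : ∃ M : Pos N₁ N₂ → n, expo M = d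
    · obtain ⟨M, rfl⟩ := h
      rw [sum_congr rfl (g := fun _ => MvPolynomial.coeff (expo M) p /
        #{M' : Pos N₁ N₂ → n | expo M' = expo M}) (fun M' hM' => by rw [(mem_filter.1 hM').2]),
        sum_const, nsmul_eq_mul, mul_div_cancel₀]
      rw [Nat.cast_ne_zero, card_ne_zero]
      exact ⟨M, by simp⟩
    · rw [filter_false_of_mem fun M _ hM => h ⟨M, hM⟩, sum_empty]
      by_contra hd
      exact h ((exists_expo_eq_iff d).2 (hp (Ne.symm hd)))

/-- A symmetric tensor is constant on the rearrangements of M, so the coefficient at `expo M` is a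
positive multiple of `f M`. -/
theorem IsSymmTensor.eq_zero {f : (Pos N₁ N₂ → n) → ℂ} (hf : IsSymmTensor f)
    (h : toPoly f = 0) : f = 0 := by
  funext M
  have h1 := coeff_toPoly f (expo M)
  rw [h, MvPolynomial.coeff_zero, sum_congr rfl (g := fun _ => f M) (fun M' hM' => by
    obtain ⟨σ, τ, rfl⟩ := (expo_eq_iff _ _).1 (mem_filter.1 hM').2
    exact hf σ τ M), sum_const, nsmul_eq_mul, eq_comm, mul_eq_zero, Nat.cast_eq_zero] at h1
  refine h1.resolve_left (card_ne_zero.2 ⟨M, by simp⟩)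

theorem IsSymmTensor.tensAct {f : (Pos N₁ N₂ → n) → ℂ} (hf : IsSymmTensor f)
    (U : Matrix n n ℂ) : IsSymmTensor (tensAct U f) := by
  intro σ τ M
  have key : ∀ L : Pos N₁ N₂ → n, L ∘ Sum.map σ τ = (Equiv.arrowCongr (Equiv.sumCongr σ τ).symm
    (Equiv.refl n)) L := fun L => rfl
  rw [tensAct_apply, tensAct_apply,
    ← Equiv.sum_comp (Equiv.arrowCongr (Equiv.sumCongr σ τ).symm (Equiv.refl n))]
  refine sum_congr rfl fun L _ => ?_
  rw [← key, hf σ τ L]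
  congr 1
  rw [← Equiv.prod_comp (Equiv.sumCongr σ τ) (fun p => twist p (U (M p) (L p)))]
  refine prod_congr rfl fun p _ => ?_
  cases p <;> rfl

/-- A bihomogeneous conjugate polynomial lifts to a tensor fixed by every matrix that fixes it. -/
theorem exists_tensor_lift {p : ConjPoly n}
    (hp : p ∈ MvPolynomial.weightedHomogeneousSubmodule ℂ (bidegree n) (N₁, N₂)) :
    ∃ f : (Pos N₁ N₂ → n) → ℂ, toPoly f = p ∧
      ∀ U : Matrix n n ℂ, conjAct U p = p → tensAct U f = f := by
  obtain ⟨f, hf, rfl⟩ := exists_symm_toPoly_eq hp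
  refine ⟨f, rfl, fun U hU => ?_⟩
  rw [conjAct_toPoly] at hU
  rw [← sub_eq_zero]
  refine IsSymmTensor.eq_zero (fun σ τ M => ?_) (by rw [map_sub, hU, sub_self])
  rw [Pi.sub_apply, Pi.sub_apply, hf.tensAct U σ τ M, hf σ τ M]

/-! ### Invariance is checked on generators. -/

theorem conjAct_mul (U V : Matrix n n ℂ) (p : ConjPoly n) :
    conjAct (U * V) p = conjAct U (conjAct V p) := by
  have h : conjAct (U * V) = (conjAct U).comp (conjAct V) := by
    refine MvPolynomial.algHom_ext fun v => ?_
    have hC : ∀ z : ℂ, conjAct U (MvPolynomial.C z) = MvPolynomial.C z := fun z =>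
      (conjAct U).commutes z
    have hX : ∀ W : Matrix n n ℂ, ∀ v, conjAct W (MvPolynomial.X v) = Sum.elim
      (fun v => ∑ w, MvPolynomial.C (W w v) * MvPolynomial.X (Sum.inl w))
      (fun v => ∑ w, MvPolynomial.C (star (W w v)) * MvPolynomial.X (Sum.inr w)) v := by
      intro W v
      simp [conjAct]
    rw [AlgHom.comp_apply, hX, hX]
    cases v <;>
    · simp only [Sum.elim_inl, Sum.elim_inr, map_sum, map_mul, hC, hX, mul_sum, Matrix.mul_apply,
        sum_mul, star_sum, star_mul']
      rw [sum_comm]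
      exact sum_congr rfl fun _ _ => sum_congr rfl fun _ _ => by ring
  rw [h, AlgHom.comp_apply]

theorem conjAct_one (p : ConjPoly n) : conjAct (1 : Matrix n n ℂ) p = p := by
  have h : conjAct (1 : Matrix n n ℂ) = AlgHom.id ℂ _ := by
    refine MvPolynomial.algHom_ext fun v => ?_
    cases v <;> simp [conjAct, Matrix.one_apply, apply_ite MvPolynomial.C, apply_ite star]
  rw [h, AlgHom.id_apply]

theorem conjAct_eq_of_mem_closure {S : Set (Matrix.unitaryGroup n ℂ)} {p : ConjPoly n}
    (h : ∀ U ∈ S, conjAct (U : Matrix n n ℂ) p = p) :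
    ∀ U ∈ Subgroup.closure S, conjAct (U : Matrix n n ℂ) p = p := by
  intro U hU
  induction hU using Subgroup.closure_induction with
  | mem U hU => exact h U hU
  | one => exact conjAct_one p
  | mul U V _ _ hU hV =>
    rw [Submonoid.coe_mul, conjAct_mul, hV, hU]
  | inv U _ hU =>
    nth_rw 1 [← hU]
    rw [← conjAct_mul, ← Submonoid.coe_mul, inv_mul_cancel]
    exact conjAct_one p

end Tensor

section Words

variable {N₁ N₂ : ℕ}

/-! ### Doubly-even and self-dual codes -/

/-- The sign with which a position enters the signed weight. -/
def posSign (p : Pos N₁ N₂) : ℤ := Sum.elim (fun _ => 1) (fun _ => -1) p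

/-- The integral lift of `β`. -/
def intBeta (x y : Word N₁ N₂) : ℤ := ∑ p, posSign p * ((x p).val * (y p).val)

theorem intBeta_comm (x y : Word N₁ N₂) : intBeta x y = intBeta y x :=
  sum_congr rfl fun p _ => by ring

theorem wt_eq_intBeta (x : Word N₁ N₂) : wt x = intBeta x x := by
  have h : ∀ z : ZMod 2, (z.val : ℤ) * z.val = z.val := by decide
  simp only [wt, intBeta, h, Fintype.sum_sum_type]
  simp [posSign, sub_eq_add_neg]

theorem wt_add (x y : Word N₁ N₂) : wt (x + y) = wt x + wt y - 2 * intBeta x y := by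
  have h : ∀ z w : ZMod 2, ((z + w).val : ℤ) * (z + w).val =
      z.val * z.val + w.val * w.val - 2 * (z.val * w.val) := by decide
  simp only [wt_eq_intBeta, intBeta, Pi.add_apply, h, mul_sum, ← sum_add_distrib,
    ← sum_sub_distrib]
  exact sum_congr rfl fun p _ => by ring

theorem beta_eq_sum (x y : Word N₁ N₂) : beta x y = ∑ p, x p * y p := by
  simp [beta, Fintype.sum_sum_type, CharTwo.sub_eq_add]

theorem beta_eq_cast (x y : Word N₁ N₂) : beta x y = (intBeta x y : ZMod 2) := by
  have h : ∀ z : ZMod 2, ((z.val : ℤ) : ZMod 2) = z := by decide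
  rw [intBeta, beta_eq_sum, Int.cast_sum]
  refine sum_congr rfl fun p _ => ?_
  cases p <;> simp [posSign, CharTwo.neg_eq]

theorem beta_eq_zero_iff (x y : Word N₁ N₂) : beta x y = 0 ↔ (2 : ℤ) ∣ intBeta x y := by
  rw [beta_eq_cast, ZMod.intCast_zmod_eq_zero_iff_dvd]; rfl

theorem beta_comm (x y : Word N₁ N₂) : beta x y = beta y x := by
  rw [beta_eq_cast, intBeta_comm, ← beta_eq_cast]

theorem beta_add_left (x y z : Word N₁ N₂) : beta (x + y) z = beta x z + beta y z := by
  simp [beta_eq_sum, add_mul, sum_add_distrib]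

theorem beta_smul_left (c : ZMod 2) (x z : Word N₁ N₂) : beta (c • x) z = c * beta x z := by
  simp only [beta_eq_sum, mul_sum, mul_assoc, Pi.smul_apply, smul_eq_mul]

/-- The dual code. -/
def dualCode (C : Code N₁ N₂) : Code N₁ N₂ where
  carrier := {y | ∀ c ∈ C, beta c y = 0}
  zero_mem' c _ := by simp [beta_eq_sum]
  add_mem' {x y} hx hy c hc := by
    rw [beta_comm, beta_add_left, beta_comm x, beta_comm y, hx c hc, hy c hc, add_zero]
  smul_mem' a x hx c hc := by
    rw [beta_comm, beta_smul_left, beta_comm x, hx c hc, mul_zero]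

theorem mem_dualCode {C : Code N₁ N₂} {y : Word N₁ N₂} :
    y ∈ dualCode C ↔ ∀ c ∈ C, beta c y = 0 := Iff.rfl

theorem isSelfDual_iff {C : Code N₁ N₂} : IsSelfDual C ↔ C = dualCode C := by
  rw [← SetLike.coe_set_eq]; rfl

theorem IsDoublyEven.beta_eq_zero {C : Code N₁ N₂} (h : IsDoublyEven C) {x y : Word N₁ N₂}
    (hx : x ∈ C) (hy : y ∈ C) : beta x y = 0 := by
  rw [beta_eq_zero_iff]
  have h1 := h _ hx
  have h2 := h _ hy
  have h3 := h _ (add_mem hx hy)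
  have h4 := wt_add x y
  omega

theorem IsDoublyEven.le_dualCode {C : Code N₁ N₂} (h : IsDoublyEven C) : C ≤ dualCode C :=
  fun _ hy _ hc => h.beta_eq_zero hc hy

theorem IsDoublyEven.mono {C D : Code N₁ N₂} (h : IsDoublyEven D) (hCD : C ≤ D) :
    IsDoublyEven C := fun _ hc => h _ (hCD hc)

/-- By `wt_add`, weights add modulo 4 on orthogonal words, so the generators decide. -/
theorem isDoublyEven_span {S : Set (Word N₁ N₂)} (h4 : ∀ x ∈ S, (4 : ℤ) ∣ wt x)
    (h2 : ∀ x ∈ S, ∀ y ∈ S, beta x y = 0) : IsDoublyEven (Submodule.span (ZMod 2) S) := by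
  have h1 : ∀ y ∈ S, y ∈ dualCode (Submodule.span (ZMod 2) S) := by
    intro y hy c hc
    have : Submodule.span (ZMod 2) S ≤ dualCode (Submodule.span (ZMod 2) {y}) := by
      refine Submodule.span_le.2 fun x hx c hc => ?_
      obtain ⟨a, rfl⟩ := Submodule.mem_span_singleton.1 hc
      rw [beta_smul_left, h2 y hy x hx, mul_zero]
    rw [beta_comm]
    exact this hc y (Submodule.mem_span_singleton_self y)
  have h3 : Submodule.span (ZMod 2) S ≤ dualCode (Submodule.span (ZMod 2) S) :=
    Submodule.span_le.2 h1
  intro c hc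
  induction hc using Submodule.span_induction with
  | mem x hx => exact h4 x hx
  | zero => simp [wt]
  | add x y hx hy hx4 hy4 =>
    have h5 := (beta_eq_zero_iff x y).1 (h3 hy x hx)
    rw [wt_add]
    omega
  | smul a x _ hx4 =>
    have : ∀ a : ZMod 2, a = 0 ∨ a = 1 := by decide
    rcases this a with rfl | rfl
    · simp [wt]
    · rwa [one_smul]

theorem IsDoublyEven.span_singleton_sup {C : Code N₁ N₂} (hC : IsDoublyEven C)
    {y : Word N₁ N₂} (hy : y ∈ dualCode C) (hy4 : (4 : ℤ) ∣ wt y) :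
    IsDoublyEven (Submodule.span (ZMod 2) {y} ⊔ C) := by
  have : Submodule.span (ZMod 2) {y} ⊔ C = Submodule.span (ZMod 2) ({y} ∪ (C : Set _)) := by
    rw [Submodule.span_union, Submodule.span_eq]
  rw [this]
  refine isDoublyEven_span ?_ ?_
  · rintro x (rfl | hx)
    · exact hy4
    · exact hC x hx
  · have hyy : beta y y = 0 := by
      rw [beta_eq_zero_iff, ← wt_eq_intBeta]
      omega
    rintro x (rfl | hx) z (rfl | hz)
    · exact hyy
    · rw [beta_comm]; exact hy z hz
    · exact hy x hx
    · exact hC.beta_eq_zero hx hz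

/-- The nontrivial additive character of `𝔽₂`. -/
def sgnChar (z : ZMod 2) : ℂ := if z = 1 then -1 else 1

theorem sgnChar_add (z w : ZMod 2) : sgnChar (z + w) = sgnChar z * sgnChar w := by
  have key : ∀ x : ZMod 2, x = 0 ∨ x = 1 := by decide
  have h : (1 + 1 : ZMod 2) = 0 := by decide
  rcases key z with rfl | rfl <;> rcases key w with rfl | rfl <;> simp [sgnChar, h]

theorem sgnChar_sum {ι : Type*} (s : Finset ι) (f : ι → ZMod 2) :
    sgnChar (∑ i ∈ s, f i) = ∏ i ∈ s, sgnChar (f i) := by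
  classical
  induction s using Finset.induction_on with
  | empty => simp [sgnChar]
  | insert a s ha ih => rw [sum_insert ha, prod_insert ha, sgnChar_add, ih]

open Classical in
theorem sum_sgnChar_beta (C : Code N₁ N₂) (y : Word N₁ N₂) :
    ∑ x : C, sgnChar (beta x.1 y) = if y ∈ dualCode C then (Nat.card C : ℂ) else 0 := by
  split_ifs with h
  · rw [sum_congr rfl (g := fun _ => 1) fun x _ => by rw [h x.1 x.2]; simp [sgnChar]]
    simp
  · rw [mem_dualCode] at h
    push Not at h
    obtain ⟨c, hc, hcy⟩ := h
    have hc1 : beta c y = 1 := by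
      have : ∀ a : ZMod 2, a ≠ 0 → a = 1 := by decide
      exact this _ hcy
    -- Translation by the codeword `c` with `beta c y = 1` permutes C and negates every term.
    have h1 : ∑ x : C, sgnChar (beta x.1 y) = - ∑ x : C, sgnChar (beta x.1 y) := by
      rw [← sum_neg_distrib]
      refine Fintype.sum_equiv (Equiv.addRight (⟨c, hc⟩ : C)) _ _ fun x => ?_
      simp [beta_add_left, sgnChar_add, hc1]
      simp [sgnChar]
    exact self_eq_neg.1 h1

theorem mem_dualCode_top {y : Word N₁ N₂} : y ∈ dualCode (⊤ : Code N₁ N₂) ↔ y = 0 := by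
  classical
  constructor
  · intro h
    funext p
    have h1 := h (Pi.single p 1) trivial
    rwa [beta_eq_sum, sum_eq_single p (fun q _ hq => by rw [Pi.single_eq_of_ne hq, zero_mul])
      (fun hp => absurd (mem_univ p) hp), Pi.single_eq_same, one_mul] at h1
  · rintro rfl
    exact zero_mem _

theorem card_word : Nat.card (Word N₁ N₂) = 2 ^ (N₁ + N₂) := by
  simp [Nat.card_eq_fintype_card]

/-- The character sum over C × 𝔽₂^(N₁+N₂) is evaluated in both orders: summing over C first leaves
the dual code, summing over words first leaves x = 0. -/
theorem card_mul_card_dualCode (C : Code N₁ N₂) :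
    Nat.card C * Nat.card (dualCode C) = 2 ^ (N₁ + N₂) := by
  classical
  have h1 : ∑ y : Word N₁ N₂, ∑ x : C, sgnChar (beta x.1 y) =
      (Nat.card C * Nat.card (dualCode C) : ℂ) := by
    simp only [sum_sgnChar_beta]
    rw [← sum_filter, sum_const, nsmul_eq_mul, mul_comm, Nat.card_eq_fintype_card (α := dualCode C),
      ← Fintype.card_subtype]
  have h2 : ∀ x : C, ∑ y : Word N₁ N₂, sgnChar (beta x.1 y) =
      if x = 0 then (2 ^ (N₁ + N₂) : ℂ) else 0 := by
    intro x
    have h3 := sum_sgnChar_beta (⊤ : Code N₁ N₂) x.1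
    rw [← Fintype.sum_equiv (Submodule.topEquiv (R := ZMod 2) (M := Word N₁ N₂)).toEquiv.symm
      (fun y => sgnChar (beta x.1 y)) _ (fun y => by rw [beta_comm]; rfl)] at h3
    rw [h3, mem_dualCode_top, ZeroMemClass.coe_eq_zero,
      Nat.card_congr (Submodule.topEquiv (R := ZMod 2) (M := Word N₁ N₂)).toEquiv, card_word]
    push_cast
    rfl
  rw [sum_comm] at h1
  simp only [h2, sum_ite_eq', mem_univ, if_true] at h1
  exact_mod_cast h1.symm

theorem IsSelfDual.card_sq {C : Code N₁ N₂} (h : IsSelfDual C) :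
    Nat.card C ^ 2 = 2 ^ (N₁ + N₂) := by
  rw [← card_mul_card_dualCode C, ← isSelfDual_iff.1 h, sq]

theorem IsDoublyEven.card_sq_lt {C : Code N₁ N₂} (h : IsDoublyEven C) (h' : ¬ IsSelfDual C) :
    Nat.card C ^ 2 < 2 ^ (N₁ + N₂) := by
  rw [← card_mul_card_dualCode C, sq]
  refine Nat.mul_lt_mul_of_pos_left ?_ Nat.card_pos
  have hlt : C < dualCode C := lt_of_le_of_ne h.le_dualCode fun e => h' (isSelfDual_iff.2 e)
  exact Set.ncard_lt_ncard (SetLike.coe_ssubset_coe.2 hlt) (Set.toFinite _)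

/-- Over 𝔽₂, z² = z, so β(c, 1) = β(c, c) = 0. -/
theorem IsSelfDual.one_mem {C : Code N₁ N₂} (hC : IsSelfDual C) : (1 : Word N₁ N₂) ∈ C := by
  have h2 : ∀ z : ZMod 2, z * z = z := by decide
  have h : (1 : Word N₁ N₂) ∈ dualCode C := by
    intro c hc
    have h1 : c ∈ dualCode C := by rwa [← isSelfDual_iff.1 hC]
    rw [← h1 c hc]
    simp [beta_eq_sum, h2]
  rwa [← isSelfDual_iff.1 hC] at h

end Words

/-! ### The action of the generators on tensors -/

section Action

variable {m N₁ N₂ : ℕ}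

/-- The rows of a basis tensor, regarded as an `m × (N₁ + N₂)` matrix. -/
def row (M : Pos N₁ N₂ → Vec m) (a : Fin m) : Word N₁ N₂ := fun p => M p a

/-- The code spanned by the rows. -/
def rowSpan (M : Pos N₁ N₂ → Vec m) : Code N₁ N₂ := Submodule.span (ZMod 2) (Set.range (row M))

theorem rowSpan_le_iff {M : Pos N₁ N₂ → Vec m} {C : Code N₁ N₂} :
    rowSpan M ≤ C ↔ ∀ a, row M a ∈ C := by
  rw [rowSpan, Submodule.span_le, Set.range_subset_iff]; rfl

theorem row_mem_rowSpan (M : Pos N₁ N₂ → Vec m) (a : Fin m) : row M a ∈ rowSpan M :=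
  Submodule.subset_span ⟨a, rfl⟩

open Classical in
/-- The tensor whose polynomial is the genus `m` complete weight enumerator of `C`. -/
def codeTensor (m : ℕ) (C : Code N₁ N₂) (M : Pos N₁ N₂ → Vec m) : ℂ :=
  if rowSpan M ≤ C then 1 else 0

theorem tensAct_permMatrix (g : Matrix.GeneralLinearGroup (Fin m) (ZMod 2)) (v' : Vec m)
    (f : (Pos N₁ N₂ → Vec m) → ℂ) (M : Pos N₁ N₂ → Vec m) :
    tensAct (permMatrix g v') f (fun p => g.1.mulVec (M p) + v') = f M := by
  have hinj : Function.Injective fun v : Vec m => g.1.mulVec v := by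
    intro v w h
    exact Matrix.mulVec_injective_of_isUnit g.isUnit h
  rw [tensAct_apply, sum_eq_single M]
  · have : ∀ p : Pos N₁ N₂, twist p (1 : ℂ) = 1 := fun p => by cases p <;> simp [twist]
    simp [permMatrix, this]
  · intro L _ hL
    obtain ⟨p, hp⟩ := Function.ne_iff.1 hL
    rw [prod_eq_zero (mem_univ p), zero_mul]
    have h0 : permMatrix g v' (g.1.mulVec (M p) + v') (L p) = 0 := by
      rw [permMatrix, Matrix.of_apply, if_neg]
      exact fun h => hp (hinj (add_right_cancel h)).symm
    rw [h0]
    cases p <;> simp [twist]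
  · simp

/-- Conjugation turns i^k into i^(-k), which is the source of the signs in the weight of the last N₂
positions. -/
theorem tensAct_diagMatrix (S : Matrix (Fin m) (Fin m) ℤ)
    (f : (Pos N₁ N₂ → Vec m) → ℂ) (M : Pos N₁ N₂ → Vec m) :
    tensAct (diagMatrix S) f M =
      Complex.I ^ (∑ a, ∑ b, S a b * intBeta (row M a) (row M b)) * f M := by
  have h0 : ∀ p : Pos N₁ N₂, twist p (0 : ℂ) = 0 := fun p => by cases p <;> simp [twist]
  have h1 : ∀ (p : Pos N₁ N₂) (k : ℤ), twist p (Complex.I ^ k) =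
      Complex.I ^ (posSign p * k) := by
    intro p k
    cases p
    · simp [twist, posSign]
    · rw [twist, Sum.elim_inr, posSign, Sum.elim_inr, neg_one_mul, zpow_neg, ← inv_zpow,
        Complex.inv_I, ← starRingEnd_apply, map_zpow₀, Complex.conj_I]
  have h2 : ∑ a, ∑ b, S a b * intBeta (row M a) (row M b) =
      ∑ p, posSign p * quadVal S (M p) := by
    simp only [intBeta, quadVal, intLift, dotProduct, Matrix.mulVec, row, mul_sum]
    rw [sum_congr rfl fun a _ => sum_comm, sum_comm]
    exact sum_congr rfl fun p _ => sum_congr rfl fun a _ => sum_congr rfl fun b _ => by ring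
  rw [tensAct_apply, sum_eq_single M]
  · congr 1
    simp only [diagMatrix, Matrix.diagonal_apply_eq, h1, h2]
    induction (univ : Finset (Pos N₁ N₂)) using Finset.induction_on with
    | empty => simp
    | insert p s hp ih => rw [prod_insert hp, sum_insert hp, zpow_add₀ Complex.I_ne_zero, ih]
  · intro L _ hL
    obtain ⟨p, hp⟩ := Function.ne_iff.1 hL
    rw [prod_eq_zero (mem_univ p), zero_mul]
    rw [diagMatrix, Matrix.diagonal_apply_ne _ (Ne.symm hp), h0]
  · simp

/-- Replace the row `j`. -/
def updateRow (M : Pos N₁ N₂ → Vec m) (j : Fin m) (x : Word N₁ N₂) : Pos N₁ N₂ → Vec m :=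
  fun p => Function.update (M p) j (x p)

theorem row_updateRow (M : Pos N₁ N₂ → Vec m) (j : Fin m) (x : Word N₁ N₂) (a : Fin m) :
    row (updateRow M j x) a = if a = j then x else row M a := by
  funext p
  by_cases h : a = j
  · subst h; simp [row, updateRow]
  · simp [row, updateRow, h]

theorem hadamard_apply (a b : ZMod 2) :
    hadamard a b = (((Real.sqrt 2)⁻¹ : ℝ) : ℂ) * sgnChar (b * a) := by
  have h : ∀ a b : ZMod 2, (a = 1 ∧ b = 1) ↔ b * a = 1 := by decide
  simp only [hadamard, Matrix.of_apply, h, sgnChar]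
  simp

theorem tensAct_hadamardAt (j : Fin m) (f : (Pos N₁ N₂ → Vec m) → ℂ) (M : Pos N₁ N₂ → Vec m) :
    tensAct (hadamardAt j) f M = (((Real.sqrt 2)⁻¹ : ℝ) : ℂ) ^ (N₁ + N₂) *
      ∑ x, sgnChar (beta x (row M j)) * f (updateRow M j x) := by
  have h0 : ∀ p : Pos N₁ N₂, twist p (0 : ℂ) = 0 := fun p => by cases p <;> simp [twist]
  have hh : ∀ (p : Pos N₁ N₂) (a b : ZMod 2), twist p (hadamard a b) = hadamard a b := by
    intro p a b
    have : ∀ z, star (sgnChar z) = sgnChar z := fun z => by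
      rw [sgnChar]; split_ifs <;> simp
    rw [hadamard_apply]
    cases p
    · rfl
    · rw [twist, Sum.elim_inr, star_mul', this]
      simp
  have hval : ∀ v w : Vec m, hadamardAt j v w =
      if ∃ i, i ≠ j ∧ v i ≠ w i then 0 else hadamard (v j) (w j) := by
    intro v w
    rw [hadamardAt, tensorMatrix, Matrix.of_apply]
    split_ifs with h
    · obtain ⟨i, hi, hvw⟩ := h
      exact prod_eq_zero (mem_univ i) (by rw [if_neg hi, Matrix.one_apply_ne hvw])
    · push Not at h
      rw [prod_eq_single j, if_pos rfl]
      · intro i _ hi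
        rw [if_neg hi, h i hi, Matrix.one_apply_eq]
      · simp
  rw [tensAct_apply, mul_sum]
  symm
  -- Only the basis tensors that agree with M outside row `j` contribute, and they are parametrized
  -- by that row.
  refine Fintype.sum_of_injective (updateRow M j) (fun x y hxy => ?_) _ _ (fun L hL => ?_)
    fun x => ?_
  · have := congrArg (fun L => row L j) hxy
    simpa [row_updateRow] using this
  · have : ∃ p i, i ≠ j ∧ M p i ≠ L p i := by
      by_contra! h
      refine hL ⟨row L j, funext fun p => funext fun i => ?_⟩
      by_cases hi : i = j
      · subst hi; simp [updateRow, row]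
      · simp [updateRow, hi, h p i hi]
    obtain ⟨p, i, hi⟩ := this
    rw [prod_eq_zero (mem_univ p), zero_mul]
    rw [hval, if_pos ⟨i, hi⟩, h0]
  · rw [← mul_assoc]
    congr 1
    have hp : ∀ p, twist p (hadamardAt j (M p) (updateRow M j x p)) =
        (((Real.sqrt 2)⁻¹ : ℝ) : ℂ) * sgnChar (x p * row M j p) := by
      intro p
      rw [hval, if_neg, hh, hadamard_apply]
      · simp [updateRow, row]
      · rintro ⟨i, hi, h⟩
        simp [updateRow, hi] at h
    rw [prod_congr rfl fun p _ => hp p, prod_mul_distrib, ← sgnChar_sum, ← beta_eq_sum]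
    simp

end Action

/-! ### Linear algebra over a field -/

section LinearAlgebra

variable {K : Type*} [Field K]

/-- Equal ranges force kernels of equal dimension. The automorphism is an isomorphism of the
kernels, after a projection, plus a section of L composed with L'. -/
theorem exists_linearEquiv_comp_eq {V W : Type*} [AddCommGroup V] [Module K V]
    [FiniteDimensional K V] [AddCommGroup W] [Module K W] (L L' : V →ₗ[K] W)
    (h : LinearMap.range L = LinearMap.range L') : ∃ φ : V ≃ₗ[K] V, ∀ v, L (φ v) = L' v := by
  obtain ⟨s, hs⟩ := L.rangeRestrict.exists_rightInverse_of_surjective L.range_rangeRestrict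
  obtain ⟨π, hπ⟩ := (LinearMap.ker L').subtype.exists_leftInverse_of_injective
    (LinearMap.ker L').ker_subtype
  have e : LinearMap.ker L' ≃ₗ[K] LinearMap.ker L := LinearEquiv.ofFinrankEq _ _ (by
    have h1 := L.finrank_range_add_finrank_ker
    have h2 := L'.finrank_range_add_finrank_ker
    rw [h] at h1
    omega)
  have hL : ∀ v, L' v ∈ LinearMap.range L := fun v => h ▸ LinearMap.mem_range_self L' v
  let φ : V →ₗ[K] V := (LinearMap.ker L).subtype ∘ₗ e.toLinearMap ∘ₗ π +
    s ∘ₗ L'.codRestrict (LinearMap.range L) hL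
  have hs' : ∀ x : LinearMap.range L, L (s x) = x := fun x =>
    congrArg Subtype.val (LinearMap.congr_fun hs x)
  have hφ : ∀ v, L (φ v) = L' v := by
    intro v
    have h0 : L (e (π v)) = 0 := (e (π v)).2
    simp [φ, h0, hs']
  have hinj : Function.Injective φ := by
    rw [← LinearMap.ker_eq_bot, LinearMap.ker_eq_bot']
    intro v hv
    have h1 : L' v = 0 := by rw [← hφ, hv, map_zero]
    have h2 : L'.codRestrict (LinearMap.range L) hL v = 0 := Subtype.ext h1
    have h3 : π v = 0 := by
      simpa [φ, h2] using hv
    have h4 := LinearMap.congr_fun hπ ⟨v, h1⟩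
    simp only [LinearMap.comp_apply, Submodule.subtype_apply, h3, LinearMap.id_apply] at h4
    exact congrArg Subtype.val h4.symm
  exact ⟨LinearEquiv.ofInjectiveEndo φ hinj, hφ⟩

theorem exists_linearEquiv_apply_eq {V : Type*} [AddCommGroup V] [Module K V]
    [FiniteDimensional K V] {u w : V} (hu : u ≠ 0) (hw : w ≠ 0) :
    ∃ φ : V ≃ₗ[K] V, φ u = w := by
  obtain ⟨φ, hφ⟩ := Submodule.exists_linearEquiv_restrict_eq
    ((LinearEquiv.toSpanNonzeroSingleton K V u hu).symm ≪≫ₗ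
      LinearEquiv.toSpanNonzeroSingleton K V w hw)
  refine ⟨φ, ?_⟩
  have := hφ (LinearEquiv.toSpanNonzeroSingleton K V u hu 1)
  rw [LinearEquiv.trans_apply, LinearEquiv.symm_apply_apply] at this
  simpa using this.symm

theorem exists_gl_mulVec_eq {m : ℕ} (φ : (Fin m → K) ≃ₗ[K] (Fin m → K)) :
    ∃ g : Matrix.GeneralLinearGroup (Fin m) K, ∀ v, g.1.mulVec v = φ v :=
  ⟨⟨LinearMap.toMatrix' φ.toLinearMap, LinearMap.toMatrix' φ.symm.toLinearMap,
    by rw [← LinearMap.toMatrix'_comp]; simp, by rw [← LinearMap.toMatrix'_comp]; simp⟩,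
    fun v => by simp [LinearMap.toMatrix'_mulVec]⟩

theorem exists_gl_vecMul_eq {m : ℕ} (φ : (Fin m → K) ≃ₗ[K] (Fin m → K)) :
    ∃ g : Matrix.GeneralLinearGroup (Fin m) K, ∀ v, Matrix.vecMul v g.1 = φ v := by
  obtain ⟨g, hg⟩ := exists_gl_mulVec_eq φ
  refine ⟨⟨g.1.transpose, g⁻¹.1.transpose, ?_, ?_⟩, fun v => ?_⟩
  · rw [← Matrix.transpose_mul, ← Units.val_mul, inv_mul_cancel, Units.val_one,
      Matrix.transpose_one]
  · rw [← Matrix.transpose_mul, ← Units.val_mul, mul_inv_cancel, Units.val_one,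
      Matrix.transpose_one]
  · rw [Matrix.vecMul_transpose, hg]

/-- A fixed vector of an operator that is triangular with respect to a spanning family `E` lies in
the span of the members of `E` that are fixed, if the other diagonal entries differ from `1`. -/
theorem mem_span_of_triangular {V ι : Type*} [AddCommGroup V] [Module K V] [Finite ι]
    [PartialOrder ι] (E : ι → V) (T : V →ₗ[K] V) (S : Set ι) (c : ι → K)
    (hS : ∀ i ∈ S, T (E i) = E i)
    (hT : ∀ i ∉ S, T (E i) - c i • E i ∈ Submodule.span K (E '' Set.Ioi i))
    (hc : ∀ i ∉ S, c i ≠ 1) {v : V} (hv : T v = v) (hspan : v ∈ Submodule.span K (Set.range E)) :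
    v ∈ Submodule.span K (E '' S) := by
  -- Elements outside `S` are discarded one at a time, a minimal one first, so that what remains is
  -- still closed upwards and its span is stable under `T`.
  have key : ∀ k : ℕ, ∀ U : Set ι, S ⊆ U → (∀ i ∈ U \ S, ∀ j, i < j → j ∈ U) →
      U.ncard = k → v ∈ Submodule.span K (E '' U) → v ∈ Submodule.span K (E '' S) := by
    intro k
    induction k with
    | zero =>
      intro U hSU _ hk hvU
      rw [Set.ncard_eq_zero] at hk
      exact Submodule.span_mono (Set.image_mono (hk ▸ Set.empty_subset S)) hvU
    | succ k ih =>
      intro U hSU hup hk hvU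
      by_cases hUS : U ⊆ S
      · exact Submodule.span_mono (Set.image_mono hUS) hvU
      obtain ⟨i₀, hi₀⟩ : ∃ i, Minimal (· ∈ U \ S) i :=
        (Set.toFinite (U \ S)).exists_minimal (Set.sdiff_nonempty.2 hUS)
      have hi₀' := hi₀.prop
      have hup' : ∀ i ∈ (U \ {i₀}) \ S, ∀ j, i < j → j ∈ U \ {i₀} := by
        intro i hi j hij
        refine ⟨hup i ⟨hi.1.1, hi.2⟩ j hij, ?_⟩
        rintro rfl
        exact hij.not_ge (hi₀.le_of_le ⟨hi.1.1, hi.2⟩ hij.le)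
      refine ih (U \ {i₀}) (fun i hi => ⟨hSU hi, fun h => hi₀'.2 (h ▸ hi)⟩) hup' ?_ ?_
      · rw [Set.ncard_sdiff_singleton_of_mem hi₀'.1, hk]; rfl
      · set Q := Submodule.span K (E '' (U \ {i₀}))
        rw [← Set.insert_sdiff_self_of_mem hi₀'.1, Set.image_insert_eq,
          Submodule.mem_span_insert] at hvU
        obtain ⟨a, w, hw, rfl⟩ := hvU
        have hTQ : Q ≤ Q.comap T := by
          refine Submodule.span_le.2 ?_
          rintro _ ⟨i, hi, rfl⟩
          by_cases hiS : i ∈ S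
          · change T (E i) ∈ Q
            rw [hS i hiS]
            exact Submodule.subset_span ⟨i, hi, rfl⟩
          · change T (E i) ∈ Q
            rw [← sub_add_cancel (T (E i)) (c i • E i)]
            refine add_mem (Submodule.span_mono (Set.image_mono ?_) (hT i hiS))
              (Q.smul_mem _ (Submodule.subset_span ⟨i, hi, rfl⟩))
            exact fun j hj => hup' i ⟨hi, hiS⟩ j hj
        have hr : T (E i₀) - c i₀ • E i₀ ∈ Q := by
          refine Submodule.span_mono (Set.image_mono ?_) (hT i₀ hi₀'.2)
          exact fun j hj => ⟨hup i₀ hi₀' j hj, (ne_of_gt hj : j ≠ i₀)⟩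
        -- With v = a E(i₀) + w, comparing T v = v modulo Q leaves (1 - c) a E(i₀) in Q.
        have hE : ((1 - c i₀) * a) • E i₀ ∈ Q := by
          have : ((1 - c i₀) * a) • E i₀ = a • (T (E i₀) - c i₀ • E i₀) + T w - w := by
            rw [map_add, map_smul] at hv
            have h1 : a • T (E i₀) = a • E i₀ + w - T w := eq_sub_of_add_eq hv
            rw [smul_sub, h1]
            module
          rw [this]
          exact sub_mem (add_mem (Q.smul_mem _ hr) (hTQ hw)) hw
        refine add_mem ?_ hw
        have h1 : (1 - c i₀) ≠ 0 := sub_ne_zero.2 (hc i₀ hi₀'.2).symm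
        have h2 := Q.smul_mem (1 - c i₀)⁻¹ hE
        rwa [smul_smul, inv_mul_cancel_left₀ h1] at h2
  refine key _ Set.univ (Set.subset_univ _) (fun _ _ _ _ => Set.mem_univ _) rfl ?_
  rwa [Set.image_univ]

/-- Off-diagonal terms come in equal pairs of even numbers. -/
theorem four_dvd_sum_of_symm {ι : Type*} (s : Finset ι) (g : ι → ι → ℤ)
    (hg : ∀ a b, g a b = g b a) (h4 : ∀ a, 4 ∣ g a a) (h2 : ∀ a b, 2 ∣ g a b) :
    4 ∣ ∑ a ∈ s, ∑ b ∈ s, g a b := by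
  classical
  induction s using Finset.induction_on with
  | empty => simp
  | insert c s hc ih =>
    have h1 : ∑ a ∈ insert c s, ∑ b ∈ insert c s, g a b =
        g c c + 2 * ∑ a ∈ s, g c a + ∑ a ∈ s, ∑ b ∈ s, g a b := by
      rw [sum_insert hc, sum_insert hc, sum_congr rfl fun a _ => sum_insert hc, sum_add_distrib,
        sum_congr rfl fun a _ => hg a c]
      ring
    have h3 : 2 ∣ ∑ a ∈ s, g c a := dvd_sum fun a _ => h2 c a
    have h5 := h4 c
    rw [h1]
    omega

end LinearAlgebra

/-! ### Row operations and invariance of weight enumerators -/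

section Invariance

variable {m N₁ N₂ : ℕ}

/-- The action of an affine map on the columns. -/
def affAct (g : Matrix.GeneralLinearGroup (Fin m) (ZMod 2)) (v' : Vec m)
    (M : Pos N₁ N₂ → Vec m) : Pos N₁ N₂ → Vec m := fun p => g.1.mulVec (M p) + v'

theorem row_affAct (g : Matrix.GeneralLinearGroup (Fin m) (ZMod 2)) (v' : Vec m)
    (M : Pos N₁ N₂ → Vec m) (a : Fin m) :
    row (affAct g v' M) a = ∑ b, g.1 a b • row M b + v' a • (1 : Word N₁ N₂) := by
  funext p
  simp [row, affAct, Matrix.mulVec, dotProduct]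

theorem rowSpan_affAct_le {g : Matrix.GeneralLinearGroup (Fin m) (ZMod 2)} {v' : Vec m}
    {M : Pos N₁ N₂ → Vec m} {C : Code N₁ N₂} (hv : v' = 0 ∨ (1 : Word N₁ N₂) ∈ C)
    (h : rowSpan M ≤ C) : rowSpan (affAct g v' M) ≤ C := by
  rw [rowSpan_le_iff] at h ⊢
  intro a
  rw [row_affAct]
  refine add_mem (sum_mem fun b _ => C.smul_mem _ (h b)) ?_
  rcases hv with rfl | h1
  · simp
  · exact C.smul_mem _ h1

theorem affAct_inv_affAct (g : Matrix.GeneralLinearGroup (Fin m) (ZMod 2)) (v' : Vec m)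
    (M : Pos N₁ N₂ → Vec m) :
    affAct g⁻¹ (g⁻¹.1.mulVec v') (affAct g v' M) = M := by
  funext p
  have h : g⁻¹.1 * g.1 = 1 := by rw [← Units.val_mul, inv_mul_cancel, Units.val_one]
  simp only [affAct, Matrix.mulVec_add, Matrix.mulVec_mulVec, h, Matrix.one_mulVec]
  -- In characteristic 2 the inverse affine map has translation part g⁻¹v', without a sign.
  have hv : ∀ w : Vec m, w + w = 0 := fun w => funext fun i => CharTwo.add_self_eq_zero (w i)
  rw [add_assoc, hv, add_zero]

theorem rowSpan_affAct_le_iff {g : Matrix.GeneralLinearGroup (Fin m) (ZMod 2)} {v' : Vec m}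
    {M : Pos N₁ N₂ → Vec m} {C : Code N₁ N₂} (hv : v' = 0 ∨ (1 : Word N₁ N₂) ∈ C) :
    rowSpan (affAct g v' M) ≤ C ↔ rowSpan M ≤ C := by
  refine ⟨fun h => ?_, rowSpan_affAct_le hv⟩
  rw [← affAct_inv_affAct g v' M]
  refine rowSpan_affAct_le ?_ h
  rcases hv with rfl | h1
  · left; simp
  · exact Or.inr h1

theorem rowSpan_affAct_zero (g : Matrix.GeneralLinearGroup (Fin m) (ZMod 2))
    (M : Pos N₁ N₂ → Vec m) : rowSpan (affAct g 0 M) = rowSpan M :=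
  le_antisymm ((rowSpan_affAct_le_iff (Or.inl rfl)).2 le_rfl)
    ((rowSpan_affAct_le_iff (g := g) (Or.inl rfl)).1 le_rfl)

/-- The rows of a matrix define a linear map from 𝔽₂^m whose range is the row span; two such maps
with the same range differ by an automorphism of the source. Thus row spans classify the orbits of
row operations. -/
theorem exists_affAct_eq_of_rowSpan_eq {M M' : Pos N₁ N₂ → Vec m}
    (h : rowSpan M = rowSpan M') :
    ∃ g : Matrix.GeneralLinearGroup (Fin m) (ZMod 2), affAct g 0 M = M' := by
  obtain ⟨φ, hφ⟩ := exists_linearEquiv_comp_eq (Fintype.linearCombination (ZMod 2) (row M))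
    (Fintype.linearCombination (ZMod 2) (row M'))
    (by rw [Fintype.range_linearCombination, Fintype.range_linearCombination]; exact h)
  obtain ⟨g, hg⟩ := exists_gl_vecMul_eq φ
  refine ⟨g, ?_⟩
  have hrow : ∀ a, row (affAct g 0 M) a = row M' a := by
    intro a
    have h1 := hφ (Pi.single a 1)
    rw [← hg, Matrix.single_one_vecMul] at h1
    rw [row_affAct]
    simpa [Fintype.linearCombination_apply, Pi.single_apply] using h1
  funext p a
  exact congrFun (hrow a) p

theorem codeTensor_diag {C : Code N₁ N₂} (hC : IsDoublyEven C)
    {S : Matrix (Fin m) (Fin m) ℤ} (hS : S.IsSymm) :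
    tensAct (diagMatrix S) (codeTensor m C) = codeTensor m C := by
  funext M
  rw [tensAct_diagMatrix, codeTensor]
  split_ifs with h
  · obtain ⟨k, hk⟩ := four_dvd_sum_of_symm univ
      (fun a b => S a b * intBeta (row M a) (row M b))
      (fun a b => by rw [intBeta_comm, hS.apply])
      (fun a => by
        rw [← wt_eq_intBeta]
        exact (hC _ (rowSpan_le_iff.1 h a)).mul_left _)
      (fun a b => ((beta_eq_zero_iff _ _).1 (hC.beta_eq_zero (rowSpan_le_iff.1 h a)
        (rowSpan_le_iff.1 h b))).mul_left _)
    rw [hk, zpow_mul]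
    have : Complex.I ^ (4 : ℤ) = 1 := by exact_mod_cast Complex.I_pow_four
    rw [this, one_zpow, one_mul]
  · rw [mul_zero]

open Classical in
theorem codeTensor_perm {C : Code N₁ N₂} (hC : (1 : Word N₁ N₂) ∈ C)
    (g : Matrix.GeneralLinearGroup (Fin m) (ZMod 2)) (v' : Vec m) :
    tensAct (permMatrix g v') (codeTensor m C) = codeTensor m C := by
  funext M
  have h : M = affAct g v' (affAct g⁻¹ (g⁻¹.1.mulVec v') M) := by
    have := affAct_inv_affAct g⁻¹ (g⁻¹.1.mulVec v') M
    rw [inv_inv, Matrix.mulVec_mulVec, ← Units.val_mul, mul_inv_cancel, Units.val_one,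
      Matrix.one_mulVec] at this
    exact this.symm
  generalize affAct g⁻¹ (g⁻¹.1.mulVec v') M = L at h
  subst h
  refine (tensAct_permMatrix g v' _ _).trans ?_
  exact if_congr (rowSpan_affAct_le_iff (Or.inr hC)).symm rfl rfl

/-- The factor that the partial Fourier transform of a code produces. -/
def dualScale (C : Code N₁ N₂) : ℝ := (Real.sqrt 2)⁻¹ ^ (N₁ + N₂) * Nat.card C

-- Replacing row `j` by its Fourier transform turns the indicator of C in that row into |C| times
-- the indicator of the dual code.
open Classical in
theorem tensAct_hadamardAt_codeTensor (j : Fin m) (C : Code N₁ N₂) (M : Pos N₁ N₂ → Vec m) :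
    tensAct (hadamardAt j) (codeTensor m C) M =
      dualScale C * if row M j ∈ dualCode C ∧ ∀ a, a ≠ j → row M a ∈ C then 1 else 0 := by
  have h1 : ∀ x, codeTensor m C (updateRow M j x) =
      if x ∈ C then (if ∀ a, a ≠ j → row M a ∈ C then 1 else 0) else 0 := by
    intro x
    rw [codeTensor, ← ite_and]
    refine if_congr ?_ rfl rfl
    rw [rowSpan_le_iff]
    constructor
    · intro h
      refine ⟨by simpa [row_updateRow] using h j, fun a ha => ?_⟩
      simpa [row_updateRow, ha] using h a
    · rintro ⟨h, h'⟩ a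
      rw [row_updateRow]
      split_ifs with ha
      · exact h
      · exact h' a ha
  rw [tensAct_hadamardAt]
  simp only [h1, mul_ite, mul_zero, mul_one]
  rw [← sum_filter, sum_subtype _ (p := (· ∈ C)) (fun x => by simp), dualScale]
  split_ifs with h2 h3 h3
  · rw [sum_sgnChar_beta, if_pos h3.1]; push_cast; rfl
  · rw [sum_sgnChar_beta, if_neg fun h => h3 ⟨h, h2⟩, mul_zero]
  · exact absurd h3.2 h2
  · simp

theorem IsSelfDual.dualScale_eq {C : Code N₁ N₂} (hC : IsSelfDual C) : dualScale C = 1 := by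
  have h1 : (Nat.card C : ℝ) = Real.sqrt 2 ^ (N₁ + N₂) := by
    rw [← sq_eq_sq₀ (by positivity) (by positivity), ← pow_mul, mul_comm, pow_mul,
      Real.sq_sqrt (by norm_num)]
    exact_mod_cast hC.card_sq
  rw [dualScale, h1, inv_pow, inv_mul_cancel₀ (by positivity)]

theorem IsDoublyEven.dualScale_lt {C : Code N₁ N₂} (hC : IsDoublyEven C) (h : ¬ IsSelfDual C) :
    dualScale C < 1 := by
  have h1 : (Nat.card C : ℝ) < Real.sqrt 2 ^ (N₁ + N₂) := by
    rw [← sq_lt_sq₀ (by positivity) (by positivity), ← pow_mul, mul_comm, pow_mul,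
      Real.sq_sqrt (by norm_num)]
    exact_mod_cast hC.card_sq_lt h
  rw [dualScale, inv_pow, inv_mul_lt_iff₀ (by positivity), mul_one]
  exact h1

theorem dualScale_nonneg (C : Code N₁ N₂) : 0 ≤ dualScale C := by
  rw [dualScale]; positivity

open Classical in
theorem codeTensor_hadamardAt {C : Code N₁ N₂} (hC : IsSelfDual C) (j : Fin m) :
    tensAct (hadamardAt j) (codeTensor m C) = codeTensor m C := by
  funext M
  rw [tensAct_hadamardAt_codeTensor, hC.dualScale_eq, ← isSelfDual_iff.1 hC, codeTensor,
    Complex.ofReal_one, one_mul]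
  refine if_congr ?_ rfl rfl
  rw [rowSpan_le_iff]
  refine ⟨fun h a => ?_, fun h => ⟨h j, fun a _ => h a⟩⟩
  by_cases ha : a = j
  · exact ha ▸ h.1
  · exact h.2 a ha

/-- Genus `m` weight enumerators of doubly-even self-dual codes are invariant. -/
theorem toPoly_codeTensor_mem {C : Code N₁ N₂} (h4 : IsDoublyEven C) (hC : IsSelfDual C) :
    toPoly (codeTensor m C) ∈ conjInvariants (cliffordGroup m) N₁ N₂ := by
  refine ⟨toPoly_mem _, conjAct_eq_of_mem_closure ?_⟩
  rintro U ((⟨S, hS, rfl⟩ | ⟨g, v', rfl⟩) | ⟨j, _, rfl⟩) <;> rw [conjAct_toPoly]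
  · rw [codeTensor_diag h4 hS]
  · rw [codeTensor_perm hC.one_mem]
  · rw [codeTensor_hadamardAt hC]

end Invariance

/-! ### Invariant tensors are spanned by code tensors -/

section Spanning

variable {m N₁ N₂ : ℕ}

/-- The binary doubly-even codes. -/
abbrev DECode (N₁ N₂ : ℕ) : Type := {C : Code N₁ N₂ // IsDoublyEven C}

/-- Each d_S acts on M by a scalar, which must be 1 on the support of a fixed tensor; as i has order
4, the exponent is divisible by 4. -/
theorem isDoublyEven_rowSpan_of_invariant {f : (Pos N₁ N₂ → Vec m) → ℂ}
    (hf : ∀ S : Matrix (Fin m) (Fin m) ℤ, S.IsSymm → tensAct (diagMatrix S) f = f)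
    {M : Pos N₁ N₂ → Vec m} (hM : f M ≠ 0) : IsDoublyEven (rowSpan M) := by
  have key : ∀ S : Matrix (Fin m) (Fin m) ℤ, S.IsSymm →
      4 ∣ ∑ a, ∑ b, S a b * intBeta (row M a) (row M b) := by
    intro S hS
    have h1 := congrFun (hf S hS) M
    rw [tensAct_diagMatrix] at h1
    have h2 := mul_right_cancel₀ hM (h1.trans (one_mul _).symm)
    have h3 : IsPrimitiveRoot Complex.I 4 := by
      rw [IsPrimitiveRoot.iff_orderOf]
      exact orderOf_eq_of_pow_and_pow_div_prime (by norm_num) Complex.I_pow_four fun p hp hdvd => by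
        have : p = 2 := by
          have : p ∣ 2 ^ 2 := hdvd
          exact (Nat.prime_dvd_prime_iff_eq hp Nat.prime_two).1 (hp.dvd_of_dvd_pow this)
        subst this
        norm_num [Complex.ext_iff]
    exact_mod_cast (h3.zpow_eq_one_iff_dvd _).1 h2
  have h4 : ∀ a, (4 : ℤ) ∣ wt (row M a) := by
    intro a
    -- S = E_aa detects the weight of row `a`; below, S = E_ab + E_ba yields twice the product of
    -- rows `a` and `b`, so that product is even.
    have := key (Matrix.single a a 1) (by simp [Matrix.IsSymm])
    simpa [Matrix.single_apply, ite_and, wt_eq_intBeta] using this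
  refine isDoublyEven_span (by rintro _ ⟨a, rfl⟩; exact h4 a) ?_
  rintro _ ⟨a, rfl⟩ _ ⟨b, rfl⟩
  rw [beta_eq_zero_iff]
  have := key (Matrix.single a b 1 + Matrix.single b a 1)
    (by rw [Matrix.IsSymm, Matrix.transpose_add, Matrix.transpose_single, Matrix.transpose_single,
      add_comm])
  simp only [Matrix.add_apply, Matrix.single_apply, add_mul, ite_and, ite_mul, one_mul, zero_mul,
    sum_add_distrib, sum_ite_eq, mem_univ, if_true, sum_ite_irrel, sum_const_zero] at this
  rw [intBeta_comm (row M b)] at this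
  omega

open Classical in
/-- The indicator of the basis tensors whose rows span `D` lies in the span of the tensors of
doubly-even codes. -/
theorem indicator_rowSpan_mem_span (D : Code N₁ N₂) (hD : IsDoublyEven D) :
    (fun M : Pos N₁ N₂ → Vec m => if rowSpan M = D then (1 : ℂ) else 0) ∈
      Submodule.span ℂ (Set.range fun C : DECode N₁ N₂ => codeTensor m C.1) := by
  induction D using WellFoundedLT.induction with
  | ind D ih =>
    have : Fintype (Code N₁ N₂) := Fintype.ofFinite _
    -- Möbius inversion: `codeTensor m D` is the sum of the indicators of all subcodes of D, and
    -- subcodes of doubly-even codes are doubly-even.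
    have h1 : (fun M : Pos N₁ N₂ → Vec m => if rowSpan M = D then (1 : ℂ) else 0) =
        codeTensor m D - ∑ D' with D' < D,
          fun M : Pos N₁ N₂ → Vec m => if rowSpan M = D' then (1 : ℂ) else 0 := by
      funext M
      simp only [Pi.sub_apply, Finset.sum_apply, codeTensor, sum_ite_eq, mem_filter, mem_univ,
        true_and]
      by_cases h : rowSpan M = D
      · simp [h]
      · by_cases h' : rowSpan M ≤ D
        · simp [h, h', lt_of_le_of_ne h' h]
        · simp [h, h', mt (le_of_lt : rowSpan M < D → _) h']
    rw [h1]
    exact sub_mem (Submodule.subset_span ⟨⟨D, hD⟩, rfl⟩) (sum_mem fun D' hD' =>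
      ih D' (mem_filter.1 hD').2 (hD.mono (mem_filter.1 hD').2.le))

theorem mem_span_codeTensor_of_invariant {f : (Pos N₁ N₂ → Vec m) → ℂ}
    (hf : ∀ S : Matrix (Fin m) (Fin m) ℤ, S.IsSymm → tensAct (diagMatrix S) f = f)
    (hg : ∀ (g : Matrix.GeneralLinearGroup (Fin m) (ZMod 2)) M, f (affAct g 0 M) = f M) :
    f ∈ Submodule.span ℂ (Set.range fun C : DECode N₁ N₂ => codeTensor m C.1) := by
  classical
  have : Fintype (Code N₁ N₂) := Fintype.ofFinite _
  have hφ : ∃ φ : Code N₁ N₂ → ℂ, ∀ M, f M = φ (rowSpan M) := by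
    -- For small m a code need not be a row span; the value 0 there is never used.
    refine ⟨fun D => if h : ∃ M : Pos N₁ N₂ → Vec m, rowSpan M = D then f h.choose else 0,
      fun M => ?_⟩
    have h : ∃ M' : Pos N₁ N₂ → Vec m, rowSpan M' = rowSpan M := ⟨M, rfl⟩
    obtain ⟨g, hgM⟩ := exists_affAct_eq_of_rowSpan_eq h.choose_spec
    beta_reduce
    rw [dif_pos h, ← hg g h.choose, hgM]
  obtain ⟨φ, hφ⟩ := hφ
  have h1 : f = ∑ D with IsDoublyEven D,
      φ D • fun M : Pos N₁ N₂ → Vec m => if rowSpan M = D then (1 : ℂ) else 0 := by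
    funext M
    simp only [Finset.sum_apply, Pi.smul_apply, smul_eq_mul, mul_ite, mul_one, mul_zero,
      sum_ite_eq, mem_filter, mem_univ, true_and]
    split_ifs with h
    · exact hφ M
    · by_contra h0
      exact h (isDoublyEven_rowSpan_of_invariant hf h0)
  rw [h1]
  exact sum_mem fun D hD => Submodule.smul_mem _ _
    (indicator_rowSpan_mem_span D (mem_filter.1 hD).2)

/-! ### The averaged partial Fourier transform -/

instance : Fintype (Matrix.GeneralLinearGroup (Fin m) (ZMod 2)) := Fintype.ofFinite _

/-- The average of `f` over the row operations, applied to a Fourier transform in one row and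
restricted to the basis tensors with doubly-even row span. -/
def parabolicFourier (j : Fin m) :
    ((Pos N₁ N₂ → Vec m) → ℂ) →ₗ[ℂ] ((Pos N₁ N₂ → Vec m) → ℂ) where
  toFun f M := by
    classical
    -- The transform lets row `j` run over the dual of C, which may contain words of weight not
    -- divisible by 4. The cut-off removes them and does not affect tensors fixed by all d_S.
    exact if IsDoublyEven (rowSpan M) then
      (Fintype.card (Matrix.GeneralLinearGroup (Fin m) (ZMod 2)) : ℂ)⁻¹ *
        ∑ g : Matrix.GeneralLinearGroup (Fin m) (ZMod 2),
          tensAct (hadamardAt j) f (affAct g 0 M)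
      else 0
  map_add' f f' := by
    funext M
    simp only [map_add, Pi.add_apply, sum_add_distrib, mul_add]
    split_ifs <;> simp
  map_smul' c f := by
    funext M
    simp only [map_smul, Pi.smul_apply, smul_eq_mul, ← mul_sum, RingHom.id_apply]
    split_ifs
    · ring
    · simp

open Classical in
theorem parabolicFourier_apply (j : Fin m) (f : (Pos N₁ N₂ → Vec m) → ℂ)
    (M : Pos N₁ N₂ → Vec m) : parabolicFourier j f M =
      if IsDoublyEven (rowSpan M) then
        (Fintype.card (Matrix.GeneralLinearGroup (Fin m) (ZMod 2)) : ℂ)⁻¹ *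
          ∑ g : Matrix.GeneralLinearGroup (Fin m) (ZMod 2),
            tensAct (hadamardAt j) f (affAct g 0 M)
      else 0 := rfl

theorem parabolicFourier_eq_self {j : Fin m} {f : (Pos N₁ N₂ → Vec m) → ℂ}
    (hf : ∀ M, f M ≠ 0 → IsDoublyEven (rowSpan M))
    (hg : ∀ (g : Matrix.GeneralLinearGroup (Fin m) (ZMod 2)) M, f (affAct g 0 M) = f M)
    (hh : tensAct (hadamardAt j) f = f) : parabolicFourier j f = f := by
  funext M
  rw [parabolicFourier_apply]
  split_ifs with h
  · simp only [hh, hg, sum_const, card_univ, nsmul_eq_mul]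
    rw [inv_mul_cancel_left₀]
    exact Nat.cast_ne_zero.2 Fintype.card_ne_zero
  · by_contra h0
    exact h (hf M (Ne.symm h0))

open Classical in
/-- The proportion of row operations that carry a given nonzero vector to a unit vector. -/
def unitProportion (j : Fin m) : ℝ :=
  (Fintype.card (Matrix.GeneralLinearGroup (Fin m) (ZMod 2)) : ℝ)⁻¹ *
    #{g : Matrix.GeneralLinearGroup (Fin m) (ZMod 2) |
      g.1.mulVec (Pi.single j 1) = Pi.single j 1}

open Classical in
theorem card_mulVec_eq_single (j : Fin m) {u : Vec m} (hu : u ≠ 0) :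
    #{g : Matrix.GeneralLinearGroup (Fin m) (ZMod 2) | g.1.mulVec u = Pi.single j 1} =
      #{g : Matrix.GeneralLinearGroup (Fin m) (ZMod 2) |
        g.1.mulVec (Pi.single j 1) = Pi.single j 1} := by
  obtain ⟨φ, hφ⟩ := exists_linearEquiv_apply_eq (K := ZMod 2) (V := Vec m) (u := Pi.single j 1)
    (w := u) (by simp) hu
  obtain ⟨g₀, hg₀⟩ := exists_gl_mulVec_eq φ
  -- Since g₀ sends the unit vector to `u`, right multiplication by g₀ matches the two sets.
  refine card_equiv (Equiv.mulRight g₀) fun g => ?_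
  rw [mem_filter, mem_filter, Equiv.coe_mulRight, Units.val_mul, ← Matrix.mulVec_mulVec, hg₀, hφ]
  simp only [mem_univ, true_and]

open Classical in
/-- The number of row operations after which a matrix lies in the support of the partial Fourier
transform of a code. -/
def goodCount (j : Fin m) (C : Code N₁ N₂) (M : Pos N₁ N₂ → Vec m) : ℕ :=
  #{g : Matrix.GeneralLinearGroup (Fin m) (ZMod 2) | row (affAct g 0 M) j ∈ dualCode C ∧
    ∀ a, a ≠ j → row (affAct g 0 M) a ∈ C}

theorem goodCount_of_le (j : Fin m) {C : Code N₁ N₂} (hC : IsDoublyEven C)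
    {M : Pos N₁ N₂ → Vec m} (hM : rowSpan M ≤ C) :
    goodCount j C M = Fintype.card (Matrix.GeneralLinearGroup (Fin m) (ZMod 2)) := by
  classical
  rw [goodCount, filter_true_of_mem, card_univ]
  intro g _
  rw [← rowSpan_affAct_zero g, rowSpan_le_iff] at hM
  exact ⟨hC.le_dualCode (hM j), fun a _ => hM a⟩

-- Write D = ⟨y⟩ + C. Modulo C the rows of M are multiples u_a y with u ≠ 0, and row operations act
-- on the vector u. The condition on row `j` is automatic because D is doubly-even, so g is counted
-- exactly when gu is the unit vector at `j`.
open Classical in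
theorem goodCount_of_covBy (j : Fin m) {C D : Code N₁ N₂} (hCD : C ⋖ D) (hD : IsDoublyEven D)
    {M : Pos N₁ N₂ → Vec m} (hMD : rowSpan M ≤ D) (hMC : ¬ rowSpan M ≤ C) :
    goodCount j C M = #{g : Matrix.GeneralLinearGroup (Fin m) (ZMod 2) |
        g.1.mulVec (Pi.single j 1) = Pi.single j 1} := by
  obtain ⟨y, hyD, hyC⟩ := SetLike.exists_of_lt hCD.lt
  have hsup : Submodule.span (ZMod 2) {y} ⊔ C = D := by
    refine (hCD.eq_or_eq le_sup_right (sup_le ?_ hCD.le)).resolve_left fun h => hyC ?_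
    · exact (Submodule.span_singleton_le_iff_mem _ _).2 hyD
    · rw [← h]
      exact Submodule.mem_sup_left (Submodule.mem_span_singleton_self y)
  have hdec : ∀ a, ∃ c : ZMod 2, row M a - c • y ∈ C := by
    intro a
    have h1 := rowSpan_le_iff.1 hMD a
    rw [← hsup, Submodule.mem_sup] at h1
    obtain ⟨z, hz, w, hw, h1⟩ := h1
    obtain ⟨c, rfl⟩ := Submodule.mem_span_singleton.1 hz
    exact ⟨c, by rwa [← h1, add_sub_cancel_left]⟩
  choose u hu using hdec
  have hrow : ∀ (g : Matrix.GeneralLinearGroup (Fin m) (ZMod 2)) a,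
      row (affAct g 0 M) a - g.1.mulVec u a • y ∈ C := by
    intro g a
    have : row (affAct g 0 M) a - g.1.mulVec u a • y =
        ∑ b, g.1 a b • (row M b - u b • y) := by
      rw [row_affAct, Matrix.mulVec, dotProduct, sum_smul]
      simp only [smul_sub, sum_sub_distrib, smul_smul, Pi.zero_apply, zero_smul, add_zero]
    rw [this]
    exact sum_mem fun b _ => C.smul_mem _ (hu b)
  have hiff : ∀ (g : Matrix.GeneralLinearGroup (Fin m) (ZMod 2)) a,
      row (affAct g 0 M) a ∈ C ↔ g.1.mulVec u a = 0 := by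
    intro g a
    have h2 := hrow g a
    constructor
    · intro h
      by_contra h0
      have h3 := sub_mem h h2
      rw [sub_sub_cancel] at h3
      exact hyC ((C.smul_mem_iff h0).1 h3)
    · intro h
      rwa [h, zero_smul, sub_zero] at h2
  have hu0 : u ≠ 0 := by
    rintro rfl
    refine hMC (rowSpan_le_iff.2 fun a => ?_)
    simpa using hu a
  rw [← card_mulVec_eq_single j hu0, goodCount]
  congr 1
  refine filter_congr fun g _ => ?_
  have hD' : row (affAct g 0 M) j ∈ dualCode C := by
    have h1 : row (affAct g 0 M) j ∈ D := by
      rw [← rowSpan_affAct_zero g, rowSpan_le_iff] at hMD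
      exact hMD j
    exact fun c hc => hD.beta_eq_zero (hCD.le hc) h1
  constructor
  · rintro ⟨_, h⟩
    have hgu : g.1.mulVec u ≠ 0 := by
      intro h0
      exact hu0 (Matrix.mulVec_injective_of_isUnit g.isUnit (by rw [h0, Matrix.mulVec_zero]))
    have h1 : g.1.mulVec u j ≠ 0 := by
      intro h0
      refine hgu (funext fun a => ?_)
      by_cases ha : a = j
      · rw [ha, h0]; rfl
      · exact (hiff g a).1 (h a ha)
    funext a
    by_cases ha : a = j
    · subst ha
      have : ∀ z : ZMod 2, z ≠ 0 → z = 1 := by decide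
      rw [this _ h1, Pi.single_eq_same]
    · rw [(hiff g a).1 (h a ha), Pi.single_eq_of_ne ha]
  · intro h
    refine ⟨hD', fun a ha => (hiff g a).2 ?_⟩
    rw [h, Pi.single_eq_of_ne ha]

/-- After a suitable row operation only row `j` lies outside C, and it lies in the dual of C with
weight divisible by 4. Adjoining it gives the required cover. -/
theorem exists_covBy_of_goodCount_ne_zero {j : Fin m} {C : Code N₁ N₂} (hC : IsDoublyEven C)
    {M : Pos N₁ N₂ → Vec m} (hM : IsDoublyEven (rowSpan M)) (hMC : ¬ rowSpan M ≤ C)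
    (h : goodCount j C M ≠ 0) : ∃ D, C ⋖ D ∧ IsDoublyEven D ∧ rowSpan M ≤ D := by
  classical
  rw [goodCount, card_ne_zero] at h
  obtain ⟨g, hg⟩ := h
  obtain ⟨h1, h2⟩ := (mem_filter.1 hg).2
  rw [← rowSpan_affAct_zero g] at hM hMC ⊢
  set M' := affAct g 0 M
  have hy : row M' j ∉ C := by
    intro hy
    refine hMC (rowSpan_le_iff.2 fun a => ?_)
    by_cases ha : a = j
    · exact ha ▸ hy
    · exact h2 a ha
  refine ⟨_, Submodule.covBy_span_singleton_sup hy,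
    hC.span_singleton_sup h1 (hM _ (row_mem_rowSpan M' j)), rowSpan_le_iff.2 fun a => ?_⟩
  by_cases ha : a = j
  · exact ha ▸ Submodule.mem_sup_left (Submodule.mem_span_singleton_self _)
  · exact Submodule.mem_sup_right (h2 a ha)

theorem covBy_unique {C D D' : Code N₁ N₂} (hD : C ⋖ D) (hD' : C ⋖ D') {X : Code N₁ N₂}
    (hX : ¬ X ≤ C) (hXD : X ≤ D) (hXD' : X ≤ D') : D = D' := by
  have key : ∀ {E : Code N₁ N₂}, C ⋖ E → X ≤ E → C ⊔ X = E := fun hE hXE =>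
    (hE.eq_or_eq le_sup_left (sup_le hE.le hXE)).resolve_left fun h =>
      hX (h ▸ le_sup_right)
  rw [← key hD hXD, ← key hD' hXD']

-- The transform has the value `dualScale C` on matrices inside C, `dualScale C * unitProportion j`
-- on those inside a doubly-even cover D but not inside C, and 0 elsewhere. Such a D is unique.
-- Inside C the tensors of all covers equal 1, whence the correction on the diagonal.
open Classical in
theorem parabolicFourier_codeTensor (j : Fin m) {C : Code N₁ N₂} (hC : IsDoublyEven C)
    (s : Finset (Code N₁ N₂)) (hs : ∀ D, D ∈ s ↔ C ⋖ D ∧ IsDoublyEven D) :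
    parabolicFourier j (codeTensor m C) =
      ((dualScale C * (1 - #s * unitProportion j) : ℝ) : ℂ) • codeTensor m C +
        ∑ D ∈ s, ((dualScale C * unitProportion j : ℝ) : ℂ) • codeTensor m D := by
  funext M
  simp only [Pi.add_apply, Pi.smul_apply, Finset.sum_apply, smul_eq_mul, ← mul_sum]
  have hcard : (Fintype.card (Matrix.GeneralLinearGroup (Fin m) (ZMod 2)) : ℂ) ≠ 0 :=
    Nat.cast_ne_zero.2 Fintype.card_ne_zero
  have hL : IsDoublyEven (rowSpan M) → parabolicFourier j (codeTensor m C) M =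
      dualScale C * ((Fintype.card (Matrix.GeneralLinearGroup (Fin m) (ZMod 2)) : ℂ)⁻¹ *
        goodCount j C M) := by
    intro hM
    rw [parabolicFourier_apply, if_pos hM]
    simp only [tensAct_hadamardAt_codeTensor, ← mul_sum]
    rw [goodCount, sum_boole]
    ring
  by_cases hMC : rowSpan M ≤ C
  · have h1 : ∀ D ∈ s, codeTensor m D M = 1 := fun D hD =>
      if_pos (hMC.trans ((hs D).1 hD).1.le)
    rw [hL (hC.mono hMC), goodCount_of_le j hC hMC, sum_congr rfl h1, codeTensor, if_pos hMC]
    rw [inv_mul_cancel₀ hcard]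
    push_cast
    simp
    ring
  · have h0 : codeTensor m C M = 0 := if_neg hMC
    rw [h0, mul_zero, zero_add]
    by_cases hD : ∃ D, C ⋖ D ∧ IsDoublyEven D ∧ rowSpan M ≤ D
    · obtain ⟨D, hCD, hDE, hMD⟩ := hD
      rw [hL (hDE.mono hMD), goodCount_of_covBy j hCD hDE hMD hMC, sum_eq_single D, codeTensor,
        if_pos hMD, unitProportion]
      · push_cast
        ring
      · intro D' hD' hne
        refine if_neg fun h => hne ?_
        exact covBy_unique ((hs D').1 hD').1 hCD hMC h hMD
      · intro h
        exact absurd ((hs D).2 ⟨hCD, hDE⟩) h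
    · rw [sum_eq_zero, mul_zero]
      · by_cases hM : IsDoublyEven (rowSpan M)
        · rw [hL hM]
          by_contra h
          refine hD (exists_covBy_of_goodCount_ne_zero (j := j) hC hM hMC fun h' => h ?_)
          rw [h', Nat.cast_zero, mul_zero, mul_zero]
        · rw [parabolicFourier_apply, if_neg hM]
      · intro D hDs
        exact if_neg fun h => hD ⟨D, ((hs D).1 hDs).1, ((hs D).1 hDs).2, h⟩

/-- Tensors invariant under the Clifford generators are spanned by those of doubly-even self-dual
codes. -/
theorem mem_span_selfDual_of_invariant {j : Fin m} {f : (Pos N₁ N₂ → Vec m) → ℂ}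
    (hf : ∀ S : Matrix (Fin m) (Fin m) ℤ, S.IsSymm → tensAct (diagMatrix S) f = f)
    (hg : ∀ g : Matrix.GeneralLinearGroup (Fin m) (ZMod 2), tensAct (permMatrix g 0) f = f)
    (hh : tensAct (hadamardAt j) f = f) :
    f ∈ Submodule.span ℂ (Set.range fun C : DESDCode N₁ N₂ => codeTensor m C.1) := by
  classical
  have : Fintype (Code N₁ N₂) := Fintype.ofFinite _
  have hg' : ∀ (g : Matrix.GeneralLinearGroup (Fin m) (ZMod 2)) M, f (affAct g 0 M) = f M := by
    intro g M
    have := tensAct_permMatrix g 0 f M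
    rwa [hg g] at this
  let cov : Code N₁ N₂ → Finset (Code N₁ N₂) := fun C => {D | C ⋖ D ∧ IsDoublyEven D}
  have hcov : ∀ C D, D ∈ cov C ↔ C ⋖ D ∧ IsDoublyEven D := fun C D => by simp [cov]
  have hp : 0 ≤ unitProportion j := by rw [unitProportion]; positivity
  have h := mem_span_of_triangular (fun C : DECode N₁ N₂ => codeTensor m C.1)
    (parabolicFourier j) {C | IsSelfDual C.1}
    (fun C => ((dualScale C.1 * (1 - #(cov C.1) * unitProportion j) : ℝ) : ℂ)) ?_ ?_ ?_
    (parabolicFourier_eq_self (fun M hM => isDoublyEven_rowSpan_of_invariant hf hM) hg' hh)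
    (mem_span_codeTensor_of_invariant hf hg')
  · refine Submodule.span_mono ?_ h
    rintro _ ⟨C, hC, rfl⟩
    exact ⟨⟨C.1, C.2, hC⟩, rfl⟩
  · intro C hC
    refine parabolicFourier_eq_self (fun M hM => ?_) (fun g M => ?_) (codeTensor_hadamardAt hC j)
    · refine C.2.mono ?_
      by_contra h'
      exact hM (if_neg h')
    · rw [codeTensor, codeTensor, rowSpan_affAct_zero]
  · intro C _
    rw [parabolicFourier_codeTensor j C.2 (cov C.1) (hcov C.1), add_sub_cancel_left]
    refine sum_mem fun D hD => Submodule.smul_mem _ _ (Submodule.subset_span ?_)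
    have hD' := (hcov _ _).1 hD
    exact ⟨⟨D, hD'.2⟩, hD'.1.lt, rfl⟩
  · intro C hC
    -- The subtracted term is nonnegative, so the entry is at most `dualScale C`, which is below 1
    -- for a code that is not self-dual.
    have h1 : dualScale C.1 * (1 - #(cov C.1) * unitProportion j) ≠ 1 := by
      have h2 : (0 : ℝ) ≤ #(cov C.1) * unitProportion j := by positivity
      have h3 := C.2.dualScale_lt hC
      have h4 := mul_nonneg (dualScale_nonneg C.1) h2
      nlinarith
    exact_mod_cast h1

/-- The conjugate invariants are spanned by the genus `m` weight enumerators of the doubly-even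
self-dual codes. -/
theorem conjInvariants_eq_span (hm : 1 ≤ m) : conjInvariants (cliffordGroup m) N₁ N₂ =
    Submodule.span ℂ (Set.range fun C : DESDCode N₁ N₂ => toPoly (codeTensor m C.1)) := by
  apply le_antisymm
  · rintro p ⟨hp, hinv⟩
    obtain ⟨f, rfl, hf⟩ := exists_tensor_lift hp
    have h := mem_span_selfDual_of_invariant (j := ⟨0, hm⟩) (f := f)
      (fun S hS => hf _ (hinv ⟨_, diagMatrix_mem S⟩
        (Subgroup.subset_closure (Or.inl (Or.inl ⟨S, hS, rfl⟩)))))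
      (fun g => hf _ (hinv ⟨_, permMatrix_mem g 0⟩
        (Subgroup.subset_closure (Or.inl (Or.inr ⟨g, 0, rfl⟩)))))
      (hf _ (hinv ⟨_, hadamardAt_mem _⟩
        (Subgroup.subset_closure (Or.inr ⟨⟨0, hm⟩, rfl, rfl⟩))))
    have h' := Submodule.mem_map_of_mem (f := toPoly) h
    rwa [Submodule.map_span, ← Set.range_comp] at h'
  · rw [Submodule.span_le]
    rintro _ ⟨C, rfl⟩
    exact toPoly_codeTensor_mem C.2.1 C.2.2

end Spanning

section Genus

variable {m m' N₁ N₂ : ℕ}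

/-! ### Comparing genera -/

/-- Extension of a vector by zeros. -/
def padZero (m' : ℕ) (v : Vec m) : Vec m' := fun i => if h : (i : ℕ) < m then v ⟨i, h⟩ else 0

theorem padZero_injective (h : m ≤ m') : Function.Injective (padZero m' : Vec m → Vec m') := by
  intro v w hvw
  funext i
  simpa [padZero] using congrFun hvw (Fin.castLE h i)

theorem rowSpan_padZero_le_iff (h : m ≤ m') (M : Pos N₁ N₂ → Vec m) (C : Code N₁ N₂) :
    rowSpan (fun p => padZero m' (M p)) ≤ C ↔ rowSpan M ≤ C := by
  rw [rowSpan_le_iff, rowSpan_le_iff]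
  constructor
  · intro H a
    convert! H (Fin.castLE h a) using 1
    funext p
    simp [row, padZero]
  · intro H a
    by_cases ha : (a : ℕ) < m
    · convert! H ⟨a, ha⟩ using 1
      funext p
      simp [row, padZero, ha]
    · convert! C.zero_mem using 1
      funext p
      simp [row, padZero, ha]

open Classical in
/-- The homomorphism that sets the variables outside `𝔽₂^m` to zero. -/
def lowerGenus (m m' : ℕ) : ConjPoly (Vec m') →ₐ[ℂ] ConjPoly (Vec m) :=
  MvPolynomial.aeval (Sum.elim
    (fun v => if v ∈ Set.range (padZero m' : Vec m → Vec m') then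
      MvPolynomial.X (Sum.inl (Function.invFun (padZero m') v)) else 0)
    (fun v => if v ∈ Set.range (padZero m' : Vec m → Vec m') then
      MvPolynomial.X (Sum.inr (Function.invFun (padZero m') v)) else 0))

open Classical in
theorem lowerGenus_X_tag (p : Pos N₁ N₂) (v : Vec m') :
    lowerGenus m m' (MvPolynomial.X (tag p v)) =
      if v ∈ Set.range (padZero m' : Vec m → Vec m') then
        MvPolynomial.X (tag p (Function.invFun (padZero m') v)) else 0 := by
  cases p <;> simp [lowerGenus, tag]

/-- Only matrices padded by zero rows survive, and zero rows do not affect containment of the row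
span in C. -/
theorem lowerGenus_toPoly_codeTensor (h : m ≤ m') (C : Code N₁ N₂) :
    lowerGenus m m' (toPoly (codeTensor m' C)) = toPoly (codeTensor m C) := by
  classical
  have hC : ∀ z : ℂ, lowerGenus m m' (MvPolynomial.C z) = MvPolynomial.C z := fun z =>
    (lowerGenus m m').commutes z
  simp only [toPoly_apply, map_sum, map_mul, map_prod, hC, lowerGenus_X_tag]
  symm
  refine Fintype.sum_of_injective (fun (M : Pos N₁ N₂ → Vec m) p => padZero m' (M p))
    (fun M L hML => funext fun p => padZero_injective h (congrFun hML p)) _ _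
    (fun M hM => ?_) fun M => ?_
  · obtain ⟨p, hp⟩ : ∃ p, M p ∉ Set.range (padZero m' : Vec m → Vec m') := by
      by_contra! H
      choose L hL using H
      exact hM ⟨L, funext hL⟩
    rw [prod_eq_zero (mem_univ p) (if_neg hp), mul_zero]
  · congr 1
    · rw [codeTensor, codeTensor]
      exact congrArg _ (if_congr (rowSpan_padZero_le_iff h M C).symm rfl rfl)
    · refine prod_congr rfl fun p _ => ?_
      rw [if_pos ⟨M p, rfl⟩, Function.leftInverse_invFun (padZero_injective h)]

/-- The invariants of genus m are a linear image of those of genus m', because spanning enumerators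
map to spanning enumerators. -/
theorem finrank_conjInvariants_mono (hm : 1 ≤ m) (h : m ≤ m') :
    Module.finrank ℂ (conjInvariants (cliffordGroup m) N₁ N₂) ≤
      Module.finrank ℂ (conjInvariants (cliffordGroup m') N₁ N₂) := by
  have h1 : conjInvariants (cliffordGroup m) N₁ N₂ =
      (conjInvariants (cliffordGroup m') N₁ N₂).map (lowerGenus m m').toLinearMap := by
    rw [conjInvariants_eq_span hm, conjInvariants_eq_span (hm.trans h), Submodule.map_span,
      ← Set.range_comp]
    congr 2
    funext C
    exact (lowerGenus_toPoly_codeTensor h C.1).symm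
  have h2 : FiniteDimensional ℂ (conjInvariants (cliffordGroup m') N₁ N₂) := by
    rw [conjInvariants_eq_span (hm.trans h)]
    exact FiniteDimensional.span_of_finite ℂ (Set.finite_range _)
  rw [h1]
  exact Submodule.finrank_map_le _ _

/-! ### Large genus -/

theorem beta_comp_perm (σ : Equiv.Perm (Fin N₁)) (τ : Equiv.Perm (Fin N₂)) (x y : Word N₁ N₂) :
    beta (x ∘ Sum.map σ τ) (y ∘ Sum.map σ τ) = beta x y := by
  rw [beta_eq_sum, beta_eq_sum, ← Equiv.sum_comp (Equiv.sumCongr σ τ) (fun p => x p * y p)]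
  rfl

open Classical in
theorem toPoly_codeTensor_eq_of_permEquiv {C D : Code N₁ N₂} (h : PermEquiv C D) :
    toPoly (codeTensor m C) = toPoly (codeTensor m D) := by
  obtain ⟨σ, τ, h⟩ := h
  rw [toPoly_eq_sum_monomial, toPoly_eq_sum_monomial]
  refine Fintype.sum_equiv (Equiv.arrowCongr (Equiv.sumCongr σ τ).symm (Equiv.refl _)) _ _
    fun M => ?_
  change _ = MvPolynomial.monomial (expo (M ∘ Sum.map σ τ)) (codeTensor m D (M ∘ Sum.map σ τ))
  rw [(expo_eq_iff _ M).2 ⟨σ, τ, rfl⟩, codeTensor, codeTensor]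
  refine congrArg _ (if_congr ?_ rfl rfl)
  rw [rowSpan_le_iff, rowSpan_le_iff]
  exact forall_congr' fun a => h (row M a)

theorem exists_rowSpan_eq (hm : N₁ + N₂ ≤ m) (D : Code N₁ N₂) :
    ∃ M : Pos N₁ N₂ → Vec m, rowSpan M = D := by
  have hk : Module.finrank (ZMod 2) D ≤ m := by
    refine (Submodule.finrank_le D).trans ?_
    simpa using hm
  let b := Module.finBasis (ZMod 2) D
  -- The rows are a basis of D followed by zero rows; there is room since dim D ≤ N₁ + N₂ ≤ m.
  refine ⟨fun p a => if h : (a : ℕ) < Module.finrank (ZMod 2) D then (b ⟨a, h⟩).1 p else 0, ?_⟩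
  apply le_antisymm
  · rw [rowSpan_le_iff]
    intro a
    by_cases h : (a : ℕ) < Module.finrank (ZMod 2) D
    · convert! (b ⟨a, h⟩).2 using 1
      funext p
      simp [row, h]
    · convert! D.zero_mem using 1
      funext p
      simp [row, h]
  · have h1 : D = Submodule.span (ZMod 2) (Set.range fun i => (b i).1) := by
      have h2 := congrArg (Submodule.map D.subtype) b.span_eq
      rw [Submodule.map_span, ← Set.range_comp, Submodule.map_top, Submodule.range_subtype] at h2
      exact h2.symm
    nth_rw 1 [h1]
    rw [Submodule.span_le]
    rintro _ ⟨i, rfl⟩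
    change (b i).1 ∈ _
    refine (congrArg (· ∈ rowSpan _) (funext fun p => ?_)).mpr
      (row_mem_rowSpan _ (Fin.castLE hk i))
    simp [row]

/-- Equal exponents give a coordinate permutation carrying D into C. Equality follows because C is
self-orthogonal: its pullback is orthogonal to D, hence contained in the dual of D, which is D. -/
theorem permEquiv_of_expo_eq {C D : Code N₁ N₂} (hC : IsDoublyEven C) (hD : IsSelfDual D)
    {M M₀ : Pos N₁ N₂ → Vec m} (hM₀ : rowSpan M₀ = D) (hM : rowSpan M ≤ C)
    (h : expo M = expo M₀) : PermEquiv D C := by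
  obtain ⟨σ, τ, rfl⟩ := (expo_eq_iff _ _).1 h
  have h1 : D ≤ C.comap (LinearMap.funLeft (ZMod 2) (ZMod 2) (Sum.map σ τ)) := by
    rw [← hM₀, rowSpan_le_iff]
    exact fun a => rowSpan_le_iff.1 hM a
  refine ⟨σ, τ, fun c => ⟨fun hc => h1 hc, fun hc => ?_⟩⟩
  rw [isSelfDual_iff.1 hD]
  intro d hd
  rw [← beta_comp_perm σ τ]
  exact hC.beta_eq_zero (h1 hd) hc

theorem finrank_conjInvariants_eq (hm : 1 ≤ m) (hN : N₁ + N₂ ≤ m) :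
    Module.finrank ℂ (conjInvariants (cliffordGroup m) N₁ N₂) = numClasses N₁ N₂ := by
  classical
  let F : Quotient (permSetoid N₁ N₂) → ConjPoly (Vec m) := fun q =>
    toPoly (codeTensor m q.out.1)
  have : Fintype (Quotient (permSetoid N₁ N₂)) := Fintype.ofFinite _
  have h1 : conjInvariants (cliffordGroup m) N₁ N₂ = Submodule.span ℂ (Set.range F) := by
    rw [conjInvariants_eq_span hm]
    congr 1
    ext p
    constructor
    · rintro ⟨C, rfl⟩
      exact ⟨Quotient.mk _ C, toPoly_codeTensor_eq_of_permEquiv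
        (Quotient.mk_out (s := permSetoid N₁ N₂) C)⟩
    · rintro ⟨q, rfl⟩
      exact ⟨q.out, rfl⟩
  have h2 : LinearIndependent ℂ F := by
    rw [Fintype.linearIndependent_iff]
    intro c hc q
    obtain ⟨M₀, hM₀⟩ := exists_rowSpan_eq hN q.out.1
    have h3 := congrArg (MvPolynomial.coeff (expo M₀)) hc
    -- The monomial of a matrix whose rows span the representative of `q` occurs in no enumerator of
    -- another class. In its own it has a positive coefficient, a count of matrices.
    rw [MvPolynomial.coeff_zero, MvPolynomial.coeff_sum, sum_eq_single q] at h3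
    · rw [MvPolynomial.coeff_smul, smul_eq_mul, mul_eq_zero, coeff_toPoly] at h3
      refine h3.resolve_right ?_
      simp only [codeTensor]
      rw [sum_boole, Nat.cast_eq_zero, ← ne_eq, card_ne_zero]
      exact ⟨M₀, by simp [hM₀]⟩
    · intro q' _ hq'
      rw [MvPolynomial.coeff_smul, coeff_toPoly, sum_eq_zero, smul_zero]
      intro M hM
      refine if_neg fun hMC => hq' ?_
      have h4 : (permSetoid N₁ N₂) q.out q'.out :=
        permEquiv_of_expo_eq q'.out.2.1 q.out.2.2 hM₀ hMC (mem_filter.1 hM).2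
      have h5 := Quotient.sound h4
      rw [Quotient.out_eq, Quotient.out_eq] at h5
      exact h5.symm
    · simp
  rw [h1, finrank_span_eq_card h2, numClasses, Nat.card_eq_fintype_card]

end Genus

end

end CliffordInv

theorem mainTheorem4 :
    (∀ m m' : ℕ, 1 ≤ m → m ≤ m' → ∀ d : Fin 2 →₀ ℕ,
      MvPowerSeries.coeff d (CliffordInv.forgerSeries (CliffordInv.cliffordGroup m)) ≤
        MvPowerSeries.coeff d (CliffordInv.forgerSeries (CliffordInv.cliffordGroup m'))) ∧
    Filter.Tendsto
      (fun m : ℕ => CliffordInv.forgerSeries (CliffordInv.cliffordGroup m))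
      Filter.atTop (nhds CliffordInv.codeSeries) := by
  refine ⟨fun m m' hm h d => CliffordInv.finrank_conjInvariants_mono hm h, ?_⟩
  rw [MvPowerSeries.WithPiTopology.tendsto_iff_coeff_tendsto]
  intro d
  refine tendsto_const_nhds.congr' ?_
  -- Each coefficient is constant once the genus is at least 1 and at least the length N₁ + N₂.
  filter_upwards [Filter.eventually_ge_atTop (max 1 (d 0 + d 1))] with m hm
  exact (CliffordInv.finrank_conjInvariants_eq (le_of_max_le_left hm)
    (le_of_max_le_right hm)).symm
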